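/- Let $S^{N-1}(\sqrt N)\subset\mathbb R^N$ be the sphere of radius $\sqrt N$ with its uniform probability measure $\sigma^N$, and let $L_N=N(Q_N-I)$ be the generator of the Kac master equation, where $$Q_N\varphi(V)=\binom N2^{-1}\sum_{i<j}\frac1{2\pi}\int_0^{2\pi}\varphi(R_{i,j,\theta}V)\,d\theta$$ and $R_{i,j,\theta}$ replaces $(v_i,v_j)$ by $(\cos\theta\,v_i-\sin\theta\,v_j,\ \sin\theta\,v_i+\cos\theta\,v_j)$ and fixes the other coordinates. For a probability density $F$ with respect to $\sigma^N$ put $H_N(F)=\int F\log F\,d\sigma^N\in[0,\infty]$ and $-\langle\log F,L_NF\rangle=-\int \log F\cdot L_NF\,d\sigma^N$; for $N\ge2$ and $H_N(F)<\infty$ the latter is well defined in $(-\infty,\infty]$, with value $+\infty$ if $F$ vanishes on a set of positive measure. Let $$\Gamma_N=\inf\Big\{\frac{-\langle\log F,L_NF\rangle}{H_N(F)}:\ F \text{ a probability density on } S^{N-1}(\sqrt N),\ 0<H_N(F)<\infty\Big\}.$$ A sequence of probability measures $\mu^{(N)}$ on $S^{N-1}(\sqrt N)$, $N\ge1$, is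 called $\mu$-chaotic, for a probability measure $\mu$ on $\mathbb R$, if each $\mu^{(N)}$ is invariant under permutations of the coordinates and, for each fixed $k\ge1$, the marginal of $\mu^{(N)}$ on $(v_1,\dots,v_k)$ converges weakly (against bounded continuous functions) to $\mu^{\otimes k}$ as $N\to\infty$. **Theorem.** For every $c>0$ there is a smooth bounded probability density $f$ on $\mathbb R$ with finite moments of all orders, $\int vf(v)\,dv=0$ and $\int v^2f(v)\,dv=1$, such that the conditioned tensor products $$F^N(v)=\frac{\prod_{j=1}^Nf(v_j)}{\int_{S^{N-1}(\sqrt N)}\prod_{j=1}^Nf(w_j)\,d\sigma^N(w)}\qquad(N\ge1)$$ are probability densities with respect to $\sigma^N$, the sequence $\{F^N\sigma^N\}_{N\ge1}$ is $f\,dv$-chaotic, $0<H_N(F^N)<\infty$ for all sufficiently large $N$, and $$\limsup_{N\to\infty}\frac{-\langle\log F^N,L_NF^N\rangle}{H_N(F^N)}\le c .$$ Consequently there is no $c>0$ such that $\Gamma_N\ge c$ for all (sufficiently large) $N$. -/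

import Mathlib

open MeasureTheory Filter Topology
open scoped ENNReal ContDiff BoundedContinuousFunction

noncomputable section

namespace KacModel

/-- The state space `S^{N-1}(√N)`, the sphere of radius `√N` in Euclidean space `ℝ^N`. -/
abbrev KacSphere (N : ℕ) : Type :=
  ↥(Metric.sphere (0 : EuclideanSpace ℝ (Fin N)) (√(N : ℝ)))

/-- The dilation from the unit sphere of `ℝ^N` onto `S^{N-1}(√N)`. -/
def dilate (N : ℕ) (v : ↥(Metric.sphere (0 : EuclideanSpace ℝ (Fin N)) 1)) : KacSphere N :=
  ⟨√(N : ℝ) • (v : EuclideanSpace ℝ (Fin N)), by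
    have hv := mem_sphere_zero_iff_norm.mp v.2
    rw [mem_sphere_zero_iff_norm, norm_smul, hv, mul_one, Real.norm_of_nonneg (Real.sqrt_nonneg _)]⟩

/-- The uniform probability measure `σ^N` on `S^{N-1}(√N)`: the normalized surface measure of the
unit sphere, transported by dilation. -/
def sigma (N : ℕ) : Measure (KacSphere N) :=
  Measure.map (dilate N)
    (((volume : Measure (EuclideanSpace ℝ (Fin N))).toSphere Set.univ)⁻¹ •
      (volume : Measure (EuclideanSpace ℝ (Fin N))).toSphere)

/-- The rotation `R_{i,j,θ}` of `ℝ^N` in the `(v_i, v_j)` plane,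
`(v_i, v_j) ↦ (cos θ v_i - sin θ v_j, sin θ v_i + cos θ v_j)`. -/
def rotVec {N : ℕ} (i j : Fin N) (θ : ℝ) (v : EuclideanSpace ℝ (Fin N)) :
    EuclideanSpace ℝ (Fin N) :=
  WithLp.toLp 2 fun k =>
    if k = i then Real.cos θ * v i - Real.sin θ * v j
    else if k = j then Real.sin θ * v i + Real.cos θ * v j
    else v k

theorem norm_rotVec {N : ℕ} {i j : Fin N} (hij : i ≠ j) (θ : ℝ) (v : EuclideanSpace ℝ (Fin N)) :
    ‖rotVec i j θ v‖ = ‖v‖ := by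
  rw [EuclideanSpace.norm_eq, EuclideanSpace.norm_eq]
  congr 1
  have hj : j ∈ Finset.univ.erase i := Finset.mem_erase.mpr ⟨hij.symm, Finset.mem_univ j⟩
  rw [← Finset.add_sum_erase _ _ (Finset.mem_univ i), ← Finset.add_sum_erase _ _ hj,
    ← Finset.add_sum_erase _ (fun k => ‖v k‖ ^ 2) (Finset.mem_univ i),
    ← Finset.add_sum_erase _ (fun k => ‖v k‖ ^ 2) hj, ← add_assoc, ← add_assoc]
  congr 1
  · simp only [rotVec, if_true, if_neg hij.symm, Real.norm_eq_abs, sq_abs]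
    nlinarith [Real.sin_sq_add_cos_sq θ]
  · refine Finset.sum_congr rfl fun k hk => ?_
    have h1 : k ≠ j := Finset.ne_of_mem_erase hk
    have h2 : k ≠ i := Finset.ne_of_mem_erase (Finset.mem_of_mem_erase hk)
    simp only [rotVec, if_neg h1, if_neg h2]

/-- The rotation `R_{i,j,θ}`, for `i < j`, as a map of `S^{N-1}(√N)` to itself. -/
def rot {N : ℕ} (p : {p : Fin N × Fin N // p.1 < p.2}) (θ : ℝ) (v : KacSphere N) : KacSphere N :=
  ⟨rotVec p.1.1 p.1.2 θ v, by
    rw [mem_sphere_zero_iff_norm, norm_rotVec p.2.ne]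
    exact mem_sphere_zero_iff_norm.mp v.2⟩

/-- The transition operator of the Kac walk,
`Q_N φ (V) = binom(N,2)⁻¹ ∑_{i<j} (2π)⁻¹ ∫_0^{2π} φ(R_{i,j,θ} V) dθ`. -/
def Q (N : ℕ) (φ : KacSphere N → ℝ) (v : KacSphere N) : ℝ :=
  ((N.choose 2 : ℕ) : ℝ)⁻¹ * ∑ p : {p : Fin N × Fin N // p.1 < p.2},
    (2 * Real.pi)⁻¹ * ∫ θ in (0 : ℝ)..(2 * Real.pi), φ (rot p θ v)

/-- The generator `L_N = N (Q_N - I)` of the Kac master equation. -/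
def L (N : ℕ) (φ : KacSphere N → ℝ) (v : KacSphere N) : ℝ :=
  (N : ℝ) * (Q N φ v - φ v)

/-- The measure `F σ^N`. -/
def densityMeasure (N : ℕ) (F : KacSphere N → ℝ) : Measure (KacSphere N) :=
  (sigma N).withDensity fun v => ENNReal.ofReal (F v)

/-- `F` is a probability density on `S^{N-1}(√N)` with respect to `σ^N`. -/
def IsProbDensity (N : ℕ) (F : KacSphere N → ℝ) : Prop :=
  Measurable F ∧ (∀ v, 0 ≤ F v) ∧ Integrable F (sigma N) ∧ ∫ v, F v ∂(sigma N) = 1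

/-- The relative entropy `H_N(F) = H(F σ^N | σ^N) ∈ [0, ∞]`. -/
def entropy (N : ℕ) (F : KacSphere N → ℝ) : ℝ≥0∞ :=
  InformationTheory.klDiv (densityMeasure N F) (sigma N)

open Classical in
/-- The entropy production `-⟨log F, L_N F⟩`, for a probability density `F` of finite entropy.
As `F log F` and the positive part of `(Q_N F) log F` are integrable for such `F`, the pairing has
a well-defined value in `(-∞, ∞]`. The value is `+∞` if `log F · L_N F` is not integrable. It is
also `+∞` if `F` vanishes on a set of positive measure, since `log F = -∞` there and (for `N ≥ 2`)
`L_N F = N Q_N F > 0` on a subset of positive measure. -/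
def entropyProduction (N : ℕ) (F : KacSphere N → ℝ) : EReal :=
  if (∀ᵐ v ∂(sigma N), 0 < F v) ∧ Integrable (fun v => Real.log (F v) * L N F v) (sigma N) then
    ((-∫ v, Real.log (F v) * L N F v ∂(sigma N) : ℝ) : EReal)
  else ⊤

/-- The ratio `-⟨log F, L_N F⟩ / H_N(F)` (meaningful when `0 < H_N(F) < ∞`). -/
def productionRatio (N : ℕ) (F : KacSphere N → ℝ) : EReal :=
  entropyProduction N F / ((entropy N F : ℝ≥0∞) : EReal)

/-- The entropy production constant `Γ_N`: the infimum of `-⟨log F, L_N F⟩ / H_N(F)` over all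
probability densities `F` with `H_N(F) < ∞` for which the ratio makes sense (`H_N(F) ≠ 0`). -/
def Gam (N : ℕ) : EReal :=
  sInf {x : EReal | ∃ F : KacSphere N → ℝ,
    IsProbDensity N F ∧ entropy N F ≠ 0 ∧ entropy N F ≠ ⊤ ∧ x = productionRatio N F}

/-- The action of a permutation of the coordinates on `S^{N-1}(√N)`. -/
def permute {N : ℕ} (π : Equiv.Perm (Fin N)) (v : KacSphere N) : KacSphere N :=
  ⟨LinearIsometryEquiv.piLpCongrLeft 2 ℝ ℝ π (v : EuclideanSpace ℝ (Fin N)), by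
    rw [mem_sphere_zero_iff_norm, LinearIsometryEquiv.norm_map]
    exact mem_sphere_zero_iff_norm.mp v.2⟩

/-- The first `k` coordinates of a point of `S^{N-1}(√N)`. Only `k ≤ N` is meaningful. -/
def firstCoords (k N : ℕ) (v : KacSphere N) : Fin k → ℝ := fun i =>
  if h : (i : ℕ) < N then (v : EuclideanSpace ℝ (Fin N)) ⟨i, h⟩ else 0

/-- Kac's chaos: a sequence of probability measures `M N` on `S^{N-1}(√N)`, `N ≥ 1`, is
`μ`-chaotic if each is symmetric under permutations of the coordinates, and for each fixed `k ≥ 1`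
the marginal on the first `k` coordinates converges weakly to `μ^{⊗k}`. -/
def IsChaotic (μ : Measure ℝ) (M : ∀ N : ℕ, Measure (KacSphere N)) : Prop :=
  (∀ N : ℕ, 1 ≤ N → IsProbabilityMeasure (M N)) ∧
  (∀ N : ℕ, 1 ≤ N → ∀ π : Equiv.Perm (Fin N), Measure.map (permute π) (M N) = M N) ∧
  ∀ k : ℕ, 1 ≤ k → ∀ χ : (Fin k → ℝ) →ᵇ ℝ,
    Tendsto (fun N : ℕ => ∫ v, χ (firstCoords k N v) ∂(M N)) atTop
      (𝓝 (∫ x, χ x ∂(Measure.pi fun _ : Fin k => μ)))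

/-- The measure `f(v) dv` on `ℝ`. -/
def lineMeasure (f : ℝ → ℝ) : Measure ℝ :=
  (volume : Measure ℝ).withDensity fun v => ENNReal.ofReal (f v)

/-- The normalization `Z_N(f, √N) = ∫ ∏_j f(v_j) dσ^N`. -/
def Z (N : ℕ) (f : ℝ → ℝ) : ℝ :=
  ∫ v : KacSphere N, ∏ j : Fin N, f ((v : EuclideanSpace ℝ (Fin N)) j) ∂(sigma N)

/-- The conditioned tensor product of `f`, as a density with respect to `σ^N`. -/
def condTensor (f : ℝ → ℝ) (N : ℕ) (v : KacSphere N) : ℝ :=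
  (∏ j : Fin N, f ((v : EuclideanSpace ℝ (Fin N)) j)) / Z N f

end KacModel

end

/-! The density is a mixture of two centred Gaussians, a fraction `1 - δ` of cold particles and a
fraction `δ` of hot ones, each population carrying half of the energy. Collisions inside a
population leave its Gaussian law invariant and contribute nothing to the dissipation; only mixed
pairs count. They have weight about `2δ` and lose `O(log (1/δ))` on average, so the dissipation per
particle is at most of order `δ log (1/δ)`. The entropy relative to the standard Gaussian does not
vanish with `δ`: nearly all particles sit at temperature close to `1/2`, and a lower bound for it
tends to `(log 2) / 2`. The ratio of the two one-particle quantities is therefore as small as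
desired (`exists_mixParam`).

The passage to `F^N` starts from exact identities. Since `F^N` is a product up to a constant, its
entropy is `N` times a one-particle average of `log f`, minus `log Z_N`; since rotations preserve
`σ^N`, its entropy production is `N` times a two-particle average of the collision loss
(`entropyProduction_condTensor`). These averages are controlled by chaos, extended to quadratically
growing functions through exact conservation of energy (`eventually_le_integral_firstCoords`). The
constant `Z_N` is compared with that of the standard Gaussian, whose tensor product is constant on
the sphere (`log_Z_le`, `log_Z_standard`).

Chaos itself needs no local central limit theorem. As `log f` is Lipschitz in `v ^ 2` on each half
line, trading the sphere for a shell of relative width `ε` costs a factor `exp (O(ε N))`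
(`shell_transfer`), and the law of large numbers puts at least half of the mass of `f^{⊗N}` in the
shell. Averages over about `N / k` independent blocks have deviations exponentially small in `N`,
which beats that factor once `ε` is small (`integral_firstCoords_le`). -/

noncomputable section

/-! ### Isometries of the sphere and polar coordinates -/

namespace KacModel

/-- The map of the sphere induced by a linear isometry. -/
def sphereMap {N : ℕ} (T : EuclideanSpace ℝ (Fin N) ≃ₗᵢ[ℝ] EuclideanSpace ℝ (Fin N))
    (v : KacSphere N) : KacSphere N :=
  ⟨T v, by
    rw [mem_sphere_zero_iff_norm, LinearIsometryEquiv.norm_map]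
    exact mem_sphere_zero_iff_norm.mp v.2⟩

/-- The map of the unit sphere induced by a linear isometry. -/
def unitSphereMap {N : ℕ} (T : EuclideanSpace ℝ (Fin N) ≃ₗᵢ[ℝ] EuclideanSpace ℝ (Fin N))
    (v : ↥(Metric.sphere (0 : EuclideanSpace ℝ (Fin N)) 1)) :
    ↥(Metric.sphere (0 : EuclideanSpace ℝ (Fin N)) 1) :=
  ⟨T v, by
    rw [mem_sphere_zero_iff_norm, LinearIsometryEquiv.norm_map]
    exact mem_sphere_zero_iff_norm.mp v.2⟩

theorem continuous_sphereMap {N : ℕ}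
    (T : EuclideanSpace ℝ (Fin N) ≃ₗᵢ[ℝ] EuclideanSpace ℝ (Fin N)) :
    Continuous (sphereMap T) :=
  (T.continuous.comp continuous_subtype_val).subtype_mk _

-- The surface measure of a set is a multiple of the volume of the cone over it. An isometry maps
-- cones to cones and preserves volume.
open scoped Pointwise in
theorem measurePreserving_unitSphereMap {N : ℕ}
    (T : EuclideanSpace ℝ (Fin N) ≃ₗᵢ[ℝ] EuclideanSpace ℝ (Fin N)) :
    MeasurePreserving (unitSphereMap T)
      (volume : Measure (EuclideanSpace ℝ (Fin N))).toSphere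
      (volume : Measure (EuclideanSpace ℝ (Fin N))).toSphere := by
  have hm : Measurable (unitSphereMap T) :=
    ((T.continuous.comp continuous_subtype_val).subtype_mk _).measurable
  refine ⟨hm, Measure.ext fun s hs => ?_⟩
  rw [Measure.map_apply hm hs, Measure.toSphere_apply' _ hs, Measure.toSphere_apply' _ (hm hs)]
  congr 1
  rw [← T.measurePreserving.measure_preimage_equiv (f := T.toMeasurableEquiv)
    (Set.Ioo (0 : ℝ) 1 • (Subtype.val '' s))]
  congr 1
  ext x
  simp only [Set.mem_smul, Set.mem_image, Set.mem_preimage, Set.mem_Ioo]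
  constructor
  · rintro ⟨r, hr, _, ⟨v, hv, rfl⟩, rfl⟩
    exact ⟨r, hr, _, ⟨_, hv, rfl⟩, (T.map_smul _ _).symm⟩
  · rintro ⟨r, hr, _, ⟨v, hv, rfl⟩, hx⟩
    refine ⟨r, hr, T.symm v, ⟨unitSphereMap T.symm v, ?_, rfl⟩, ?_⟩
    · convert hv
      ext1
      simp [unitSphereMap]
    · rw [← map_smul, hx]
      exact T.symm_apply_apply x

theorem continuous_dilate (N : ℕ) : Continuous (dilate N) :=
  Continuous.subtype_mk (by fun_prop) _

theorem measurePreserving_sphereMap {N : ℕ}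
    (T : EuclideanSpace ℝ (Fin N) ≃ₗᵢ[ℝ] EuclideanSpace ℝ (Fin N)) :
    MeasurePreserving (sphereMap T) (sigma N) (sigma N) := by
  refine ⟨(continuous_sphereMap T).measurable, ?_⟩
  have hd := (continuous_dilate N).measurable
  have hT := measurePreserving_unitSphereMap T
  have hc : sphereMap T ∘ dilate N = dilate N ∘ unitSphereMap T := by
    ext v : 2
    simp [sphereMap, dilate, unitSphereMap]
  rw [sigma, Measure.map_map (continuous_sphereMap T).measurable hd, hc,
    ← Measure.map_map hd hT.measurable, Measure.map_smul, hT.map_eq]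

theorem isProbabilityMeasure_sigma {N : ℕ} (hN : 1 ≤ N) : IsProbabilityMeasure (sigma N) := by
  have : Nonempty (Fin N) := ⟨⟨0, hN⟩⟩
  have h0 : (volume : Measure (EuclideanSpace ℝ (Fin N))).toSphere Set.univ ≠ 0 :=
    Measure.measure_univ_ne_zero.mpr (Measure.toSphere_ne_zero _)
  have : IsProbabilityMeasure
      (((volume : Measure (EuclideanSpace ℝ (Fin N))).toSphere Set.univ)⁻¹ •
        (volume : Measure (EuclideanSpace ℝ (Fin N))).toSphere) :=
    ⟨by simpa using ENNReal.inv_mul_cancel h0 (measure_ne_top _ _)⟩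
  exact Measure.isProbabilityMeasure_map (continuous_dilate N).measurable.aemeasurable

/-- Integration in polar coordinates: Lebesgue measure on `ℝ^N` is a mixture of the dilates of the
uniform measure `σ^N`. -/
theorem exists_polar_measure {N : ℕ} (hN : 1 ≤ N) : ∃ ρ : Measure ℝ, (∀ᵐ r ∂ρ, 0 < r) ∧
    ∀ φ : EuclideanSpace ℝ (Fin N) → ℝ≥0∞, Measurable φ →
      ∫⁻ x, φ x = ∫⁻ r, ∫⁻ v : KacSphere N, φ (r • (v : EuclideanSpace ℝ (Fin N))) ∂(sigma N) ∂ρ := by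
  have : Nonempty (Fin N) := ⟨⟨0, hN⟩⟩
  have hs : 0 < √(N : ℝ) := Real.sqrt_pos.mpr (by exact_mod_cast hN)
  set μ := (volume : Measure (EuclideanSpace ℝ (Fin N)))
  have h0 : μ.toSphere Set.univ ≠ 0 :=
    Measure.measure_univ_ne_zero.mpr (Measure.toSphere_ne_zero _)
  -- Radii are measured in units of `√N`, so that `r = 1` is the sphere carrying `σ^N`.
  have hg : Measurable fun r : Set.Ioi (0 : ℝ) => (r : ℝ) / √(N : ℝ) := by fun_prop
  refine ⟨μ.toSphere Set.univ • Measure.map (fun r : Set.Ioi (0 : ℝ) => (r : ℝ) / √(N : ℝ))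
    (Measure.volumeIoiPow (Module.finrank ℝ (EuclideanSpace ℝ (Fin N)) - 1)), ?_, ?_⟩
  · refine Measure.ae_smul_measure ?_ _
    rw [ae_map_iff hg.aemeasurable measurableSet_Ioi]
    exact ae_of_all _ fun r => div_pos r.2 hs
  · intro φ hφ
    have hφ2 : Measurable fun p : ℝ × KacSphere N =>
        φ (p.1 • (p.2 : EuclideanSpace ℝ (Fin N))) := by fun_prop
    have hpm := μ.measurePreserving_homeomorphUnitSphereProd
    calc ∫⁻ x, φ x ∂μ = ∫⁻ x in {(0 : EuclideanSpace ℝ (Fin N))}ᶜ, φ x ∂μ := by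
          rw [restrict_compl_singleton]
      _ = ∫⁻ x : ({(0 : EuclideanSpace ℝ (Fin N))}ᶜ : Set _), φ x ∂(μ.comap Subtype.val) := by
          rw [lintegral_subtype_comap (measurableSet_singleton _).compl]
      _ = ∫⁻ p, φ ((p.2 : ℝ) • (p.1 : EuclideanSpace ℝ (Fin N))) ∂(μ.toSphere.prod
            (Measure.volumeIoiPow (Module.finrank ℝ (EuclideanSpace ℝ (Fin N)) - 1))) := by
          rw [← hpm.lintegral_comp (by fun_prop)]
          refine lintegral_congr fun x => ?_
          congr 1
          have := (homeomorphUnitSphereProd (EuclideanSpace ℝ (Fin N))).symm_apply_apply x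
          rw [← homeomorphUnitSphereProd_symm_apply_coe, this]
      _ = _ := by
          have : SFinite (sigma N) := by
            have := isProbabilityMeasure_sigma hN
            infer_instance
          have hI : Measurable fun r : ℝ =>
              ∫⁻ v, φ (r • (v : EuclideanSpace ℝ (Fin N))) ∂(sigma N) :=
            hφ2.lintegral_prod_right'
          rw [lintegral_prod_symm' _ (by fun_prop), lintegral_smul_measure,
            lintegral_map hI hg, smul_eq_mul]
          refine Eq.trans ?_ (lintegral_const_mul _ (hI.comp hg))
          refine lintegral_congr fun r => ?_
          rw [sigma, lintegral_map (by fun_prop) (continuous_dilate N).measurable,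
            lintegral_smul_measure, smul_eq_mul, ← mul_assoc,
            ENNReal.mul_inv_cancel h0 (measure_ne_top _ _), one_mul]
          refine lintegral_congr fun v => ?_
          simp only [dilate]
          rw [smul_smul, div_mul_cancel₀ _ hs.ne']

/-! ### Radial densities and the comparison of sphere and shell -/

/-- Probability densities on the line with second moment one and moments of all orders, whose
logarithm is a Lipschitz function of `v ^ 2` on each half line. -/
structure RadialDensity (f : ℝ → ℝ) (K : ℝ) : Prop where
  pos : ∀ v, 0 < f v
  cont : Continuous f
  integrable_pow : ∀ k : ℕ, Integrable fun v : ℝ => |v| ^ k * f v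
  mass : ∫ v, f v = 1
  second : ∫ v, v ^ 2 * f v = 1
  nonneg_const : 0 ≤ K
  scale : ∀ r v, 0 < r → f (r * v) ≤ Real.exp (K * |r ^ 2 - 1| * v ^ 2) * f v

/-- The shell `(1 - ε) N ≤ ‖x‖ ^ 2 ≤ (1 + ε) N`. -/
def shell (N : ℕ) (ε : ℝ) : Set (EuclideanSpace ℝ (Fin N)) :=
  {x | |‖x‖ ^ 2 - N| ≤ ε * N}

theorem measurableSet_shell (N : ℕ) (ε : ℝ) : MeasurableSet (shell N ε) :=
  measurableSet_le (by fun_prop) (by fun_prop)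

theorem norm_sq_kacSphere {N : ℕ} (v : KacSphere N) :
    ‖(v : EuclideanSpace ℝ (Fin N))‖ ^ 2 = N := by
  rw [mem_sphere_zero_iff_norm.mp v.2, Real.sq_sqrt (Nat.cast_nonneg N)]

theorem sum_sq_kacSphere {N : ℕ} (v : KacSphere N) :
    ∑ j, (v : EuclideanSpace ℝ (Fin N)) j ^ 2 = N := by
  have h := norm_sq_kacSphere v
  rw [EuclideanSpace.norm_sq_eq] at h
  simpa using h

theorem smul_mem_shell_iff {N : ℕ} (hN : 1 ≤ N) {ε r : ℝ} (v : KacSphere N) :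
    r • (v : EuclideanSpace ℝ (Fin N)) ∈ shell N ε ↔ |r ^ 2 - 1| ≤ ε := by
  have hN' : (0 : ℝ) < N := by exact_mod_cast hN
  rw [shell, Set.mem_ofPred_eq, norm_smul, mul_pow, norm_sq_kacSphere, Real.norm_eq_abs, sq_abs,
    show r ^ 2 * (N : ℝ) - N = (r ^ 2 - 1) * N by ring, abs_mul, abs_of_pos hN',
    mul_le_mul_iff_left₀ hN']

/-- Comparison of integrals over the sphere with integrals over a thin shell: if `Φ` and `Ψ` vary
little along rays inside the shell, then the `Ψ`-average of `Φ / Ψ` on the sphere is controlled by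
integrals over the whole space. -/
theorem shell_transfer {N : ℕ} (hN : 1 ≤ N) {ε : ℝ} {Φ Φ' Ψ : EuclideanSpace ℝ (Fin N) → ℝ≥0∞}
    (_hΦ : Measurable Φ) (hΦ' : Measurable Φ') (hΨ : Measurable Ψ) {A B : ℝ≥0∞}
    (h1 : ∀ v : KacSphere N, ∀ r : ℝ, 0 < r → |r ^ 2 - 1| ≤ ε →
      Φ v ≤ A * Φ' (r • (v : EuclideanSpace ℝ (Fin N))))
    (h2 : ∀ v : KacSphere N, ∀ r : ℝ, 0 < r → |r ^ 2 - 1| ≤ ε →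
      Ψ (r • (v : EuclideanSpace ℝ (Fin N))) ≤ B * Ψ v) :
    (∫⁻ x in shell N ε, Ψ x) * ∫⁻ v : KacSphere N, Φ v ∂(sigma N) ≤
      B * (∫⁻ v : KacSphere N, Ψ v ∂(sigma N)) * (A * ∫⁻ x, Φ' x) := by
  obtain ⟨ρ, hρ, hpol⟩ := exists_polar_measure hN
  have := isProbabilityMeasure_sigma hN
  set R : Set ℝ := {r | |r ^ 2 - 1| ≤ ε}
  have hR : MeasurableSet R := measurableSet_le (by fun_prop) (by fun_prop)
  have e1 : ∫⁻ x in shell N ε, Ψ x ≤ (B * ∫⁻ v : KacSphere N, Ψ v ∂(sigma N)) * ρ R := by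
    rw [← lintegral_indicator (measurableSet_shell N ε),
      hpol _ (hΨ.indicator (measurableSet_shell N ε)), ← lintegral_indicator_const hR]
    refine lintegral_mono_ae ?_
    filter_upwards [hρ] with r hr
    by_cases hrR : r ∈ R
    · rw [Set.indicator_of_mem hrR, ← lintegral_const_mul _ (by fun_prop)]
      refine lintegral_mono fun v => ?_
      rw [Set.indicator_of_mem ((smul_mem_shell_iff hN v).mpr hrR)]
      exact h2 v r hr hrR
    · rw [Set.indicator_of_notMem hrR, nonpos_iff_eq_zero]
      refine (lintegral_congr fun v => ?_).trans lintegral_zero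
      exact Set.indicator_of_notMem (fun h => hrR ((smul_mem_shell_iff hN v).mp h)) _
  have e2 : ρ R * ∫⁻ v : KacSphere N, Φ v ∂(sigma N) ≤ A * ∫⁻ x, Φ' x := by
    rw [mul_comm, ← lintegral_indicator_const hR, hpol _ hΦ',
      ← lintegral_const_mul _ (by fun_prop)]
    refine lintegral_mono_ae ?_
    filter_upwards [hρ] with r hr
    by_cases hrR : r ∈ R
    · rw [Set.indicator_of_mem hrR, ← lintegral_const_mul _ (by fun_prop)]
      exact lintegral_mono fun v => h1 v r hr hrR
    · rw [Set.indicator_of_notMem hrR]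
      exact zero_le
  -- The radial mass `ρ R` of the shell bounds one integral from above and enters the other as a
  -- factor. Multiplying the two bounds eliminates it without a division, so it need not be nonzero
  -- or finite.
  calc (∫⁻ x in shell N ε, Ψ x) * ∫⁻ v : KacSphere N, Φ v ∂(sigma N)
      ≤ ((B * ∫⁻ v : KacSphere N, Ψ v ∂(sigma N)) * ρ R) *
          ∫⁻ v : KacSphere N, Φ v ∂(sigma N) := by gcongr
    _ = (B * ∫⁻ v : KacSphere N, Ψ v ∂(sigma N)) *
          (ρ R * ∫⁻ v : KacSphere N, Φ v ∂(sigma N)) := by ring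
    _ ≤ _ := by gcongr

namespace RadialDensity

variable {f : ℝ → ℝ} {K : ℝ}

theorem integrable (hf : RadialDensity f K) : Integrable f := by
  simpa using hf.integrable_pow 0

theorem isProbabilityMeasure (hf : RadialDensity f K) :
    IsProbabilityMeasure (lineMeasure f) := by
  refine ⟨?_⟩
  rw [lineMeasure, withDensity_apply _ MeasurableSet.univ, Measure.restrict_univ,
    ← ofReal_integral_eq_lintegral_ofReal hf.integrable (ae_of_all _ fun v => (hf.pos v).le),
    hf.mass, ENNReal.ofReal_one]

theorem integral_lineMeasure (hf : RadialDensity f K) (g : ℝ → ℝ) :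
    ∫ v, g v ∂(lineMeasure f) = ∫ v, g v * f v := by
  rw [lineMeasure, integral_withDensity_eq_integral_toReal_smul
    (hf.cont.measurable.ennreal_ofReal) (ae_of_all _ fun _ => ENNReal.ofReal_lt_top)]
  refine integral_congr_ae (ae_of_all _ fun v => ?_)
  simp [ENNReal.toReal_ofReal (hf.pos v).le, mul_comm]

theorem integrable_lineMeasure_iff (hf : RadialDensity f K) (g : ℝ → ℝ) :
    Integrable g (lineMeasure f) ↔ Integrable fun v => g v * f v := by
  rw [lineMeasure, integrable_withDensity_iff (hf.cont.measurable.ennreal_ofReal)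
    (ae_of_all _ fun _ => ENNReal.ofReal_lt_top)]
  simp only [ENNReal.toReal_ofReal (hf.pos _).le]

theorem integrable_abs_pow (hf : RadialDensity f K) (k : ℕ) :
    Integrable (fun v => |v| ^ k) (lineMeasure f) :=
  (hf.integrable_lineMeasure_iff _).mpr (hf.integrable_pow k)

theorem pi_lineMeasure (hf : RadialDensity f K) (N : ℕ) :
    Measure.pi (fun _ : Fin N => lineMeasure f) =
      (volume : Measure (Fin N → ℝ)).withDensity fun y => ENNReal.ofReal (∏ j, f (y j)) := by
  have := hf.isProbabilityMeasure
  refine Measure.pi_eq fun s hs => ?_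
  rw [withDensity_apply _ (MeasurableSet.univ_pi hs), volume_pi, Measure.restrict_pi_pi,
    ← ofReal_integral_eq_lintegral_ofReal
      (Integrable.fintype_prod fun j => hf.integrable.integrableOn)
      (ae_of_all _ fun y => Finset.prod_nonneg fun j _ => (hf.pos _).le),
    integral_fintype_prod_eq_prod,
    ENNReal.ofReal_prod_of_nonneg fun j _ => integral_nonneg fun v => (hf.pos v).le]
  refine Finset.prod_congr rfl fun j _ => ?_
  rw [lineMeasure, withDensity_apply _ (hs j),
    ofReal_integral_eq_lintegral_ofReal hf.integrable.integrableOn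
      (ae_of_all _ fun v => (hf.pos v).le)]

theorem lintegral_pi (hf : RadialDensity f K) (N : ℕ) {G : EuclideanSpace ℝ (Fin N) → ℝ≥0∞}
    (hG : Measurable G) :
    ∫⁻ x : EuclideanSpace ℝ (Fin N), G x * ENNReal.ofReal (∏ j, f (x j)) =
      ∫⁻ y, G (WithLp.toLp 2 y) ∂(Measure.pi fun _ : Fin N => lineMeasure f) := by
  have hc := hf.cont
  rw [hf.pi_lineMeasure, lintegral_withDensity_eq_lintegral_mul _ (by fun_prop) (by fun_prop),
    ← (PiLp.volume_preserving_toLp (Fin N)).lintegral_comp (by fun_prop)]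
  refine lintegral_congr fun y => ?_
  simp [mul_comm]

theorem memLp_sq (hf : RadialDensity f K) : MemLp (fun v : ℝ => v ^ 2) 2 (lineMeasure f) := by
  rw [memLp_two_iff_integrable_sq (by fun_prop)]
  refine (hf.integrable_abs_pow 4).congr (ae_of_all _ fun v => ?_)
  simp only
  rw [← pow_mul, show 2 * 2 = 4 by norm_num, Even.pow_abs (by decide)]

/-- The law of large numbers for the energy: most of the mass of `f^{⊗N}` lies in the shell. -/
theorem shell_mass (hf : RadialDensity f K) {ε : ℝ} (hε : 0 < ε) : ∀ᶠ N : ℕ in atTop,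
    2⁻¹ ≤ ∫⁻ x in shell N ε, ENNReal.ofReal (∏ j, f (x j)) := by
  have := hf.isProbabilityMeasure
  set V := ProbabilityTheory.variance (fun v : ℝ => v ^ 2) (lineMeasure f)
  have hlim : Tendsto (fun N : ℕ => V / ε ^ 2 * ((N : ℝ))⁻¹) atTop (𝓝 0) := by
    simpa using (tendsto_inv_atTop_nhds_zero_nat (𝕜 := ℝ)).const_mul (V / ε ^ 2)
  filter_upwards [hlim.eventually_le_const (show (0 : ℝ) < 2⁻¹ by norm_num),
    eventually_ge_atTop 1] with N hV hN
  have hN' : (0 : ℝ) < N := by exact_mod_cast hN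
  set X : (Fin N → ℝ) → ℝ := ∑ j, fun y : Fin N → ℝ => (fun v : ℝ => v ^ 2) (y j)
  set P := Measure.pi fun _ : Fin N => lineMeasure f
  have hmem : ∀ j : Fin N, MemLp (fun y : Fin N → ℝ => (fun v : ℝ => v ^ 2) (y j)) 2 P := fun j =>
    hf.memLp_sq.comp_measurePreserving (measurePreserving_eval _ j)
  have hX : MemLp X 2 P := memLp_finsetSum' _ fun j _ => hmem j
  have hvar : ProbabilityTheory.variance X P = N * V := by
    rw [ProbabilityTheory.variance_sum_pi fun _ => hf.memLp_sq]
    simp [V]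
  have hmean : ∫ y, X y ∂P = N := by
    simp only [X, Finset.sum_apply]
    rw [integral_finsetSum _ fun j _ => (hmem j).integrable one_le_two]
    have h1 : ∀ j : Fin N, ∫ y : Fin N → ℝ, y j ^ 2 ∂P = 1 := fun j => by
      rw [show (∫ y : Fin N → ℝ, y j ^ 2 ∂P) = ∫ v, v ^ 2 ∂(lineMeasure f) from
        integral_comp_eval (μ := fun _ : Fin N => lineMeasure f) (f := fun v : ℝ => v ^ 2)
          (by fun_prop), hf.integral_lineMeasure, hf.second]
    simp [h1]
  -- Chebyshev's inequality: the energy has mean `N` and variance `N V`, so the complement of the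
  -- shell has mass at most `V / (ε ^ 2 N)`, which is at most `1/2` by the choice of `N`.
  have hch := ProbabilityTheory.meas_ge_le_variance_div_sq hX (mul_pos hε hN')
  rw [hvar, hmean] at hch
  have hle : P {y | ε * N ≤ |X y - N|} ≤ 2⁻¹ := by
    refine hch.trans ?_
    rw [show (2⁻¹ : ℝ≥0∞) = ENNReal.ofReal 2⁻¹ by
      rw [ENNReal.ofReal_inv_of_pos (by norm_num)]; norm_num]
    refine ENNReal.ofReal_le_ofReal (le_trans (le_of_eq ?_) hV)
    field_simp
  have hXs : ∀ y : Fin N → ℝ, ‖(WithLp.toLp 2 y : EuclideanSpace ℝ (Fin N))‖ ^ 2 = X y := by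
    intro y
    rw [EuclideanSpace.norm_sq_eq]
    simp [X]
  have hm : Measurable ((shell N ε).indicator (1 : EuclideanSpace ℝ (Fin N) → ℝ≥0∞)) :=
    measurable_one.indicator (measurableSet_shell N ε)
  have hS : MeasurableSet (WithLp.toLp 2 ⁻¹' shell N ε : Set (Fin N → ℝ)) :=
    (measurableSet_shell N ε).preimage (by fun_prop)
  calc (2⁻¹ : ℝ≥0∞) = 1 - 2⁻¹ := by rw [ENNReal.one_sub_inv_two]
    _ ≤ P (WithLp.toLp 2 ⁻¹' shell N ε) := by
        rw [tsub_le_iff_right, ← measure_univ (μ := P), ← measure_add_measure_compl hS]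
        gcongr
        refine (measure_mono fun y hy => ?_).trans hle
        simp only [shell, Set.mem_compl_iff, Set.mem_preimage, Set.mem_ofPred_eq, not_le, hXs] at hy
        exact hy.le
    _ = _ := by
        rw [← lintegral_indicator_one hS, ← lintegral_indicator (measurableSet_shell N ε)]
        refine (hf.lintegral_pi N hm).symm.trans (lintegral_congr fun x => ?_)
        by_cases hx : x ∈ shell N ε <;> simp [hx]

end RadialDensity

/-! ### Coordinates, permutations and independent blocks -/

theorem integrable_of_continuous {N : ℕ} {μ : Measure (KacSphere N)} [IsFiniteMeasure μ]
    {g : KacSphere N → ℝ} (hg : Continuous g) : Integrable g μ := by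
  rw [← integrableOn_univ]
  exact hg.continuousOn.integrableOn_compact isCompact_univ

theorem continuous_firstCoords (k N : ℕ) : Continuous (firstCoords k N) := by
  refine continuous_pi fun i => ?_
  by_cases h : (i : ℕ) < N
  · simp only [firstCoords, h, dif_pos]
    fun_prop
  · simp only [firstCoords, h, dif_neg, not_false_eq_true]
    fun_prop

theorem firstCoords_eq {k N : ℕ} (h : k ≤ N) (v : KacSphere N) :
    firstCoords k N v = fun j => (v : EuclideanSpace ℝ (Fin N)) (Fin.castLE h j) := by
  funext j
  rw [firstCoords, dif_pos (j.2.trans_le h)]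
  rfl

theorem permute_apply {N : ℕ} (π : Equiv.Perm (Fin N)) (v : KacSphere N) (i : Fin N) :
    (permute π v : EuclideanSpace ℝ (Fin N)) i = (v : EuclideanSpace ℝ (Fin N)) (π.symm i) := by
  simp [permute, LinearIsometryEquiv.piLpCongrLeft_apply]

theorem measurePreserving_permute {N : ℕ} (π : Equiv.Perm (Fin N)) :
    MeasurePreserving (permute π) (sigma N) (sigma N) :=
  measurePreserving_sphereMap (LinearIsometryEquiv.piLpCongrLeft 2 ℝ ℝ π)

/-- Independence passes to the subfamily of coordinates selected by an injection, and each
coordinate keeps the law `μ`. -/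
theorem pi_map_comp_injective {ι κ : Type*} [Fintype ι] [Fintype κ] (μ : Measure ℝ)
    [IsProbabilityMeasure μ] {e : ι → κ} (he : Function.Injective e) :
    Measure.map (fun (y : κ → ℝ) i => y (e i)) (Measure.pi fun _ => μ) =
      Measure.pi fun _ => μ := by
  have h := (ProbabilityTheory.iIndepFun_pi (μ := fun _ : κ => μ) (X := fun _ => id)
    fun _ => aemeasurable_id).precomp he
  simp only [id] at h
  rw [ProbabilityTheory.iIndepFun_iff_map_fun_eq_pi_map
    fun i => (measurable_pi_apply (e i)).aemeasurable] at h
  rw [h]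
  congr 1
  funext i
  exact (measurePreserving_eval (fun _ : κ => μ) (e i)).map_eq

theorem pi_map_curry {ι κ : Type*} [Fintype ι] [Fintype κ] (μ : Measure ℝ)
    [IsProbabilityMeasure μ] :
    Measure.map (fun (y : ι × κ → ℝ) i j => y (i, j)) (Measure.pi fun _ => μ) =
      Measure.pi fun _ => Measure.pi fun _ => μ := by
  have h : Measure.map (MeasurableEquiv.curry ι κ ℝ).symm
      (Measure.pi fun _ : ι => Measure.pi fun _ : κ => μ) = Measure.pi fun _ => μ := by
    refine (Measure.pi_eq fun s hs => ?_).symm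
    rw [MeasurableEquiv.map_apply]
    have : (MeasurableEquiv.curry ι κ ℝ).symm ⁻¹' Set.pi Set.univ s =
        Set.pi Set.univ fun i => Set.pi Set.univ fun j => s (i, j) := by
      ext y
      simp [MeasurableEquiv.coe_curry_symm, Function.uncurry, Set.mem_pi]
    rw [this, Measure.pi_pi]
    simp only [Measure.pi_pi]
    rw [Fintype.prod_prod_type]
  rw [← h]
  exact (MeasurableEquiv.curry ι κ ℝ).map_map_symm

/-- Exponential moments of sums over disjoint blocks of independent coordinates. -/
theorem integral_exp_sum_blocks {M k N : ℕ} (μ : Measure ℝ) [IsProbabilityMeasure μ]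
    {e : Fin M × Fin k → Fin N} (he : Function.Injective e) {h : (Fin k → ℝ) → ℝ}
    (hh : Measurable h) :
    ∫⁻ y : Fin N → ℝ, ENNReal.ofReal (Real.exp (∑ i, h fun j => y (e (i, j))))
        ∂(Measure.pi fun _ => μ) =
      (∫⁻ z, ENNReal.ofReal (Real.exp (h z)) ∂(Measure.pi fun _ => μ)) ^ M := by
  have h1 : Measurable fun y : Fin M → Fin k → ℝ => ENNReal.ofReal (Real.exp (∑ i, h (y i))) := by
    fun_prop
  have h2 : Measurable fun y : Fin M × Fin k → ℝ =>
      ENNReal.ofReal (Real.exp (∑ i, h fun j => y (i, j))) := by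
    fun_prop
  rw [← lintegral_map (μ := Measure.pi fun _ => μ) (g := fun (y : Fin N → ℝ) i => y (e i)) h2
      (by fun_prop), pi_map_comp_injective μ he,
    ← lintegral_map (g := fun (y : Fin M × Fin k → ℝ) i j => y (i, j)) h1 (by fun_prop),
    pi_map_curry]
  simp only [Real.exp_sum, ENNReal.ofReal_prod_of_nonneg fun _ _ => (Real.exp_pos _).le]
  have hind := ProbabilityTheory.iIndepFun_pi
    (μ := fun _ : Fin M => Measure.pi fun _ : Fin k => μ)
    (X := fun _ z => ENNReal.ofReal (Real.exp (h z))) fun _ => by fun_prop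
  rw [ProbabilityTheory.lintegral_prod_eq_prod_lintegral_of_indepFun Finset.univ _ hind
    fun i => by fun_prop]
  have hev : ∀ i : Fin M, ∫⁻ y : Fin M → Fin k → ℝ, ENNReal.ofReal (Real.exp (h (y i)))
      ∂(Measure.pi fun _ => Measure.pi fun _ => μ) =
      ∫⁻ z, ENNReal.ofReal (Real.exp (h z)) ∂(Measure.pi fun _ => μ) := fun i =>
    (measurePreserving_eval (fun _ : Fin M => Measure.pi fun _ : Fin k => μ) i).lintegral_comp
      (f := fun z => ENNReal.ofReal (Real.exp (h z))) (by fun_prop)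
  simp [hev]

theorem condTensor_permute {N : ℕ} (f : ℝ → ℝ) (π : Equiv.Perm (Fin N)) (v : KacSphere N) :
    condTensor f N (permute π v) = condTensor f N v := by
  simp only [condTensor, permute_apply]
  rw [Equiv.prod_comp π.symm fun j => f ((v : EuclideanSpace ℝ (Fin N)) j)]

/-- Permutations of the coordinates preserve the conditioned tensor product. -/
theorem map_permute_densityMeasure {N : ℕ} {f : ℝ → ℝ} (hf : Continuous f)
    (π : Equiv.Perm (Fin N)) :
    Measure.map (permute π) (densityMeasure N (condTensor f N)) =
      densityMeasure N (condTensor f N) := by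
  have hπ := measurePreserving_permute π
  have hF : Measurable (condTensor f N) := by
    unfold condTensor
    fun_prop
  refine Measure.ext fun s hs => ?_
  rw [Measure.map_apply hπ.measurable hs, densityMeasure,
    withDensity_apply _ (hπ.measurable hs), withDensity_apply _ hs, ← hπ.setLIntegral_comp_preimage hs
      (by fun_prop)]
  simp only [condTensor_permute]

/-! ### The conditioned tensor product against the tensor product -/

namespace RadialDensity

variable {f : ℝ → ℝ} {K : ℝ}

theorem continuous_prod (hf : RadialDensity f K) (N : ℕ) :
    Continuous fun v : KacSphere N => ∏ j, f ((v : EuclideanSpace ℝ (Fin N)) j) := by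
  have := hf.cont
  fun_prop

theorem continuous_condTensor (hf : RadialDensity f K) (N : ℕ) :
    Continuous (condTensor f N) :=
  (hf.continuous_prod N).div_const _

theorem Z_pos (hf : RadialDensity f K) {N : ℕ} (hN : 1 ≤ N) : 0 < Z N f := by
  have := isProbabilityMeasure_sigma hN
  refine (integral_pos_iff_support_of_nonneg
    (fun _ => Finset.prod_nonneg fun _ _ => (hf.pos _).le)
    (integrable_of_continuous (hf.continuous_prod N))).mpr ?_
  have : Function.support (fun v : KacSphere N => ∏ j, f ((v : EuclideanSpace ℝ (Fin N)) j)) =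
      Set.univ :=
    Set.eq_univ_of_forall fun _ => (Finset.prod_pos fun _ _ => hf.pos _).ne'
  rw [this, measure_univ]
  exact one_pos

theorem condTensor_pos (hf : RadialDensity f K) {N : ℕ} (hN : 1 ≤ N) (v : KacSphere N) :
    0 < condTensor f N v :=
  div_pos (Finset.prod_pos fun _ _ => hf.pos _) (hf.Z_pos hN)

theorem isProbDensity (hf : RadialDensity f K) {N : ℕ} (hN : 1 ≤ N) :
    IsProbDensity N (condTensor f N) := by
  have := isProbabilityMeasure_sigma hN
  refine ⟨(hf.continuous_condTensor N).measurable, fun v => (hf.condTensor_pos hN v).le,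
    integrable_of_continuous (hf.continuous_condTensor N), ?_⟩
  simp only [condTensor]
  rw [integral_div]
  exact div_self (hf.Z_pos hN).ne'

theorem isProbabilityMeasure_densityMeasure (hf : RadialDensity f K) {N : ℕ} (hN : 1 ≤ N) :
    IsProbabilityMeasure (densityMeasure N (condTensor f N)) := by
  obtain ⟨-, h0, hi, h1⟩ := hf.isProbDensity hN
  refine ⟨?_⟩
  rw [densityMeasure, withDensity_apply _ MeasurableSet.univ, Measure.restrict_univ,
    ← ofReal_integral_eq_lintegral_ofReal hi (ae_of_all _ h0), h1, ENNReal.ofReal_one]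

theorem integral_densityMeasure (hf : RadialDensity f K) {N : ℕ} (hN : 1 ≤ N)
    (g : KacSphere N → ℝ) :
    ∫ v, g v ∂(densityMeasure N (condTensor f N)) =
      ∫ v, condTensor f N v * g v ∂(sigma N) := by
  rw [densityMeasure, integral_withDensity_eq_integral_toReal_smul
    (hf.continuous_condTensor N).measurable.ennreal_ofReal
    (ae_of_all _ fun _ => ENNReal.ofReal_lt_top)]
  refine integral_congr_ae (ae_of_all _ fun v => ?_)
  simp [ENNReal.toReal_ofReal (hf.condTensor_pos hN v).le]

/-- All `k`-particle marginals of the conditioned tensor product agree. -/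
theorem integral_marginal (hf : RadialDensity f K) {k N : ℕ} (h : k ≤ N) {e : Fin k → Fin N}
    (he : Function.Injective e) {g : (Fin k → ℝ) → ℝ} (hg : Continuous g) :
    ∫ v : KacSphere N, g (fun j => (v : EuclideanSpace ℝ (Fin N)) (e j))
        ∂(densityMeasure N (condTensor f N)) =
      ∫ v, g (firstCoords k N v) ∂(densityMeasure N (condTensor f N)) := by
  -- Some permutation of all coordinates carries the chosen ones to the first `k`, and the
  -- conditioned law is invariant under it.
  obtain ⟨π, hπ⟩ := Equiv.Perm.exists_extending_pair e (Fin.castLE h) he (Fin.castLE_injective h)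
  conv_rhs => rw [← map_permute_densityMeasure hf.cont π]
  have hgc : Continuous fun v => g (firstCoords k N v) := hg.comp (continuous_firstCoords k N)
  rw [integral_map (measurePreserving_permute π).measurable.aemeasurable
    hgc.aestronglyMeasurable]
  refine integral_congr_ae (ae_of_all _ fun v => ?_)
  simp only [firstCoords_eq h, permute_apply, ← hπ, Equiv.symm_apply_apply]

/-- The one-sided hypothesis `scale` is self-dual: apply it with factor `r⁻¹` at the point `r * v`
and use `|r⁻¹ ^ 2 - 1| * r ^ 2 = |r ^ 2 - 1|`. -/
theorem le_scale (hf : RadialDensity f K) (r v : ℝ) (hr : 0 < r) :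
    f v ≤ Real.exp (K * |r ^ 2 - 1| * v ^ 2) * f (r * v) := by
  have h := hf.scale r⁻¹ (r * v) (inv_pos.mpr hr)
  rw [inv_mul_cancel_left₀ hr.ne'] at h
  have h1 : |r⁻¹ ^ 2 - 1| * r ^ 2 = |r ^ 2 - 1| := by
    conv_lhs => rw [← abs_of_pos (pow_pos hr 2)]
    rw [← abs_mul, sub_mul, ← mul_pow, inv_mul_cancel₀ hr.ne', abs_sub_comm]
    simp
  rwa [mul_pow, mul_assoc K, ← mul_assoc |_|, h1, ← mul_assoc] at h

/-- On the sphere the energy is exactly `N`, so the exponents `K * ε * v_j ^ 2` add up to `K * ε *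
N` at every point. -/
theorem prod_scale_le (hf : RadialDensity f K) {N : ℕ} {ε r : ℝ} (hr : 0 < r)
    (hε : |r ^ 2 - 1| ≤ ε) (v : KacSphere N) :
    ∏ j, f (r * (v : EuclideanSpace ℝ (Fin N)) j) ≤
      Real.exp (K * ε * N) * ∏ j, f ((v : EuclideanSpace ℝ (Fin N)) j) := by
  have hK := hf.nonneg_const
  calc ∏ j, f (r * (v : EuclideanSpace ℝ (Fin N)) j)
      ≤ ∏ j, Real.exp (K * ε * (v : EuclideanSpace ℝ (Fin N)) j ^ 2) *
          f ((v : EuclideanSpace ℝ (Fin N)) j) := by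
        refine Finset.prod_le_prod (fun j _ => (hf.pos _).le) fun j _ => ?_
        refine (hf.scale _ _ hr).trans ?_
        have := (hf.pos ((v : EuclideanSpace ℝ (Fin N)) j)).le
        gcongr
    _ = _ := by
        rw [Finset.prod_mul_distrib, ← Real.exp_sum, ← Finset.mul_sum, sum_sq_kacSphere]

theorem prod_le_scale (hf : RadialDensity f K) {N : ℕ} {ε r : ℝ} (hr : 0 < r)
    (hε : |r ^ 2 - 1| ≤ ε) (v : KacSphere N) :
    ∏ j, f ((v : EuclideanSpace ℝ (Fin N)) j) ≤
      Real.exp (K * ε * N) * ∏ j, f (r * (v : EuclideanSpace ℝ (Fin N)) j) := by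
  have hK := hf.nonneg_const
  calc ∏ j, f ((v : EuclideanSpace ℝ (Fin N)) j)
      ≤ ∏ j, Real.exp (K * ε * (v : EuclideanSpace ℝ (Fin N)) j ^ 2) *
          f (r * (v : EuclideanSpace ℝ (Fin N)) j) := by
        refine Finset.prod_le_prod (fun j _ => (hf.pos _).le) fun j _ => ?_
        set x := (v : EuclideanSpace ℝ (Fin N)) j
        have := (hf.pos (r * x)).le
        refine (hf.le_scale r x hr).trans ?_
        gcongr
    _ = _ := by
        rw [Finset.prod_mul_distrib, ← Real.exp_sum, ← Finset.mul_sum, sum_sq_kacSphere]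

/-- Exponential-scale comparison of the conditioned tensor product with the tensor product. -/
theorem condTensor_transfer (hf : RadialDensity f K) {N : ℕ} (hN : 1 ≤ N) {ε : ℝ}
    (hmass : 2⁻¹ ≤ ∫⁻ x in shell N ε, ENNReal.ofReal (∏ j, f (x j)))
    {G : EuclideanSpace ℝ (Fin N) → ℝ} (hG : Continuous G) {κ : ℝ}
    (hκ : ∀ v : KacSphere N, ∀ r : ℝ, 0 < r → |r ^ 2 - 1| ≤ ε →
      G v ≤ κ + G (r • (v : EuclideanSpace ℝ (Fin N)))) :
    ENNReal.ofReal (∫ v : KacSphere N, Real.exp (G v) ∂(densityMeasure N (condTensor f N))) ≤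
      ENNReal.ofReal (2 * Real.exp (κ + 2 * (K * ε * N))) *
        ∫⁻ y, ENNReal.ofReal (Real.exp (G (WithLp.toLp 2 y)))
          ∂(Measure.pi fun _ : Fin N => lineMeasure f) := by
  have := isProbabilityMeasure_sigma hN
  have hc := hf.cont
  have hZ := hf.Z_pos hN
  have hpos : ∀ x : EuclideanSpace ℝ (Fin N), 0 ≤ ∏ j, f (x j) := fun x =>
    Finset.prod_nonneg fun j _ => (hf.pos _).le
  -- One factor `exp (K * ε * N)` pays for moving the numerator of `F^N` from the sphere into the
  -- shell, the other for bounding the normalization from below by the mass of the shell. The factor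
  -- `2` of the conclusion inverts that mass.
  have key := shell_transfer (ε := ε) hN
    (Φ := fun x => ENNReal.ofReal (Real.exp (G x) * ∏ j, f (x j)))
    (Φ' := fun x => ENNReal.ofReal (Real.exp (G x)) * ENNReal.ofReal (∏ j, f (x j)))
    (Ψ := fun x => ENNReal.ofReal (∏ j, f (x j)))
    (A := ENNReal.ofReal (Real.exp (κ + K * ε * N))) (B := ENNReal.ofReal (Real.exp (K * ε * N)))
    (by fun_prop) (by fun_prop) (by fun_prop) ?_ ?_
  · have eZ : ∫⁻ v : KacSphere N, ENNReal.ofReal (∏ j, f ((v : EuclideanSpace ℝ (Fin N)) j))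
        ∂(sigma N) = ENNReal.ofReal (Z N f) :=
      (ofReal_integral_eq_lintegral_ofReal (integrable_of_continuous (hf.continuous_prod N))
        (ae_of_all _ fun v => hpos v)).symm
    have eF : ENNReal.ofReal (∫ v : KacSphere N, Real.exp (G v)
          ∂(densityMeasure N (condTensor f N))) * ENNReal.ofReal (Z N f) =
        ∫⁻ v : KacSphere N, ENNReal.ofReal
          (Real.exp (G v) * ∏ j, f ((v : EuclideanSpace ℝ (Fin N)) j)) ∂(sigma N) := by
      have hc' : Continuous fun v : KacSphere N =>
          Real.exp (G v) * ∏ j, f ((v : EuclideanSpace ℝ (Fin N)) j) := by fun_prop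
      rw [← ofReal_integral_eq_lintegral_ofReal (integrable_of_continuous hc')
        (ae_of_all _ fun v => mul_nonneg (Real.exp_pos _).le (hpos v)),
        ← ENNReal.ofReal_mul' hZ.le, hf.integral_densityMeasure hN, ← integral_mul_const]
      congr 1
      refine integral_congr_ae (ae_of_all _ fun v => ?_)
      simp only [condTensor]
      field_simp
    rw [eZ, ← eF, hf.lintegral_pi N (by fun_prop)] at key
    set I := ∫⁻ y, ENNReal.ofReal (Real.exp (G (WithLp.toLp 2 y)))
          ∂(Measure.pi fun _ : Fin N => lineMeasure f)
    set E := ENNReal.ofReal (∫ v : KacSphere N, Real.exp (G v)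
          ∂(densityMeasure N (condTensor f N)))
    have hZ0 : ENNReal.ofReal (Z N f) ≠ 0 := by simpa using hZ
    rw [← ENNReal.mul_le_mul_iff_left hZ0 ENNReal.ofReal_ne_top,
      ← ENNReal.mul_le_mul_iff_right (a := 2⁻¹) (by simp) (by simp)]
    calc 2⁻¹ * (E * ENNReal.ofReal (Z N f))
        ≤ (∫⁻ x in shell N ε, ENNReal.ofReal (∏ j, f (x j))) * (E * ENNReal.ofReal (Z N f)) := by
          gcongr
      _ ≤ _ := key
      _ = 2⁻¹ * (ENNReal.ofReal (2 * Real.exp (κ + 2 * (K * ε * N))) * I *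
            ENNReal.ofReal (Z N f)) := by
          rw [show κ + 2 * (K * ε * N) = K * ε * N + (κ + K * ε * N) by ring,
            Real.exp_add (K * ε * N),
            ENNReal.ofReal_mul (by norm_num), ENNReal.ofReal_mul (Real.exp_pos _).le,
            ENNReal.ofReal_ofNat]
          refine (one_mul _).symm.trans ?_
          rw [← ENNReal.inv_mul_cancel (a := 2) (by simp) (by simp)]
          ring
  · intro v r hr hε
    rw [← ENNReal.ofReal_mul (Real.exp_pos _).le, ← ENNReal.ofReal_mul (Real.exp_pos _).le]
    refine ENNReal.ofReal_le_ofReal ?_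
    have h1 := Real.exp_le_exp.mpr (hκ v r hr hε)
    have h2 := hf.prod_le_scale hr hε v
    rw [Real.exp_add] at h1
    calc _ ≤ (Real.exp κ * Real.exp (G (r • (v : EuclideanSpace ℝ (Fin N))))) *
          (Real.exp (K * ε * N) * ∏ j, f (r * (v : EuclideanSpace ℝ (Fin N)) j)) := by
            gcongr
            exact hpos v
      _ = _ := by
          rw [Real.exp_add]
          simp only [PiLp.smul_apply, smul_eq_mul]
          ring
  · intro v r hr hε
    rw [← ENNReal.ofReal_mul (Real.exp_pos _).le]
    exact ENNReal.ofReal_le_ofReal (hf.prod_scale_le hr hε v)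

end RadialDensity

/-! ### Chaos from exponential moments over blocks -/

/-- The embedding of `M` consecutive blocks of length `k` into `Fin N`. -/
def blockIndex {M k N : ℕ} (h : M * k ≤ N) (p : Fin M × Fin k) : Fin N :=
  Fin.castLE h (finProdFinEquiv p)

theorem blockIndex_injective {M k N : ℕ} (h : M * k ≤ N) :
    Function.Injective (blockIndex h) :=
  (Fin.castLE_injective h).comp finProdFinEquiv.injective

theorem abs_sub_one_le_abs_sq_sub_one {r : ℝ} (hr : 0 < r) : |r - 1| ≤ |r ^ 2 - 1| := by
  rw [show r ^ 2 - 1 = (r - 1) * (r + 1) by ring, abs_mul, abs_of_pos (by linarith : 0 < r + 1)]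
  nlinarith [abs_nonneg (r - 1)]

namespace RadialDensity

variable {f : ℝ → ℝ} {K : ℝ}

/-- By exchangeability the marginal mean of `g` is the mean of its average over `M` disjoint blocks.
Jensen's inequality bounds the exponential of that mean by an exponential moment,
`condTensor_transfer` moves it to the tensor product, and there the blocks are independent and
Hoeffding's lemma applies. Taking logarithms gives the estimate; divided by `lam * M` the transfer
error is `O(ε)`, because `N / M` will be of order `k`. -/
theorem integral_firstCoords_le (hf : RadialDensity f K) {k N M : ℕ} (hk : 1 ≤ k)
    (hM : 1 ≤ M) (hMN : M * k ≤ N) {ε : ℝ}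
    (hmass : 2⁻¹ ≤ ∫⁻ x in shell N ε, ENNReal.ofReal (∏ j, f (x j)))
    {g : (Fin k → ℝ) → ℝ} {L : NNReal} (hL : LipschitzWith L g) {B : ℝ} (hB : ∀ z, |g z| ≤ B)
    {lam : ℝ} (hlam : 0 < lam) :
    lam * M * (∫ v, g (firstCoords k N v) ∂(densityMeasure N (condTensor f N)) -
        ∫ z, g z ∂(Measure.pi fun _ : Fin k => lineMeasure f)) ≤
      Real.log 2 + 2 * lam * L * ε * N + 2 * (K * ε * N) + M * (B ^ 2 * lam ^ 2 / 2) := by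
  have hkN : k ≤ N := le_trans (Nat.le_mul_of_pos_left k hM) hMN
  have hN : 1 ≤ N := hk.trans hkN
  have := hf.isProbabilityMeasure
  have := hf.isProbabilityMeasure_densityMeasure hN
  have hgc := hL.continuous
  set m := ∫ z, g z ∂(Measure.pi fun _ : Fin k => lineMeasure f)
  set P := densityMeasure N (condTensor f N)
  set e := blockIndex hMN
  have he : Function.Injective e := blockIndex_injective hMN
  set S : EuclideanSpace ℝ (Fin N) → ℝ := fun x =>
    ∑ i : Fin M, lam * (g (fun j => x (e (i, j))) - m)
  have hS : Continuous S := by fun_prop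
  have hei : ∀ i : Fin M, Function.Injective fun j => e (i, j) := fun i j j' h =>
    (Prod.ext_iff.mp (he h)).2
  have hmean : ∫ v : KacSphere N, S v ∂P =
      lam * M * (∫ v, g (firstCoords k N v) ∂P - m) := by
    simp only [S]
    rw [integral_finsetSum _ fun i _ => integrable_of_continuous (by fun_prop)]
    have : ∀ i : Fin M, ∫ v : KacSphere N, lam * (g (fun j =>
        (v : EuclideanSpace ℝ (Fin N)) (e (i, j))) - m) ∂P =
        lam * (∫ v, g (firstCoords k N v) ∂P - m) := fun i => by
      rw [integral_const_mul, integral_sub (integrable_of_continuous (by fun_prop))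
        (integrable_const _), hf.integral_marginal hkN (hei i) hgc]
      simp [P]
    simp only [this]
    simp
    ring
  have hjensen : Real.exp (∫ v : KacSphere N, S v ∂P) ≤ ∫ v : KacSphere N, Real.exp (S v) ∂P :=
    convexOn_exp.map_integral_le Real.continuous_exp.continuousOn isClosed_univ
      (ae_of_all _ fun _ => Set.mem_univ _) (integrable_of_continuous (by fun_prop))
      (integrable_of_continuous (by fun_prop))
  have hosc : ∀ v : KacSphere N, ∀ r : ℝ, 0 < r → |r ^ 2 - 1| ≤ ε →
      S v ≤ 2 * lam * L * ε * N + S (r • (v : EuclideanSpace ℝ (Fin N))) := by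
    intro v r hr hε
    have hε0 : 0 ≤ ε := (abs_nonneg _).trans hε
    have hblock : ∀ i : Fin M, g (fun j => (v : EuclideanSpace ℝ (Fin N)) (e (i, j))) -
        g (fun j => r * (v : EuclideanSpace ℝ (Fin N)) (e (i, j))) ≤
        L * (ε * (1 + ∑ j, (v : EuclideanSpace ℝ (Fin N)) (e (i, j)) ^ 2)) := by
      intro i
      refine (le_abs_self _).trans ((hL.dist_le_mul _ _).trans ?_)
      refine mul_le_mul_of_nonneg_left ?_ L.2
      refine (dist_pi_le_iff (by positivity)).mpr fun j => ?_
      set x := (v : EuclideanSpace ℝ (Fin N)) (e (i, j)) with hx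
      have h1 : x ^ 2 ≤ ∑ j, (v : EuclideanSpace ℝ (Fin N)) (e (i, j)) ^ 2 :=
        Finset.single_le_sum (f := fun j => (v : EuclideanSpace ℝ (Fin N)) (e (i, j)) ^ 2)
          (fun j _ => sq_nonneg _) (Finset.mem_univ j)
      rw [Real.dist_eq, show x - r * x = -((r - 1) * x) by ring, abs_neg, abs_mul]
      refine mul_le_mul ((abs_sub_one_le_abs_sq_sub_one hr).trans hε) ?_ (abs_nonneg _) hε0
      -- The displacement is linear in `|x|`; trading it for `1 + x ^ 2` lets the errors of all
      -- blocks be summed by the conserved energy, giving the bound `2 * N` below.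
      have h2 : |x| ≤ 1 + x ^ 2 := by
        rw [← sq_abs]
        nlinarith [sq_nonneg (|x| - 1), abs_nonneg x]
      linarith
    have hsum : ∑ i : Fin M, (1 + ∑ j, (v : EuclideanSpace ℝ (Fin N)) (e (i, j)) ^ 2) ≤
        2 * (N : ℝ) := by
      rw [Finset.sum_add_distrib, ← Fintype.sum_prod_type'
        (f := fun i j => (v : EuclideanSpace ℝ (Fin N)) (e (i, j)) ^ 2)]
      have h1 : ∑ p : Fin M × Fin k, (v : EuclideanSpace ℝ (Fin N)) (e p) ^ 2 ≤ N := by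
        refine le_of_le_of_eq ?_ (sum_sq_kacSphere v)
        rw [← Finset.sum_image (f := fun j => (v : EuclideanSpace ℝ (Fin N)) j ^ 2)
          (s := Finset.univ) (g := e) fun _ _ _ _ h => he h]
        exact Finset.sum_le_univ_sum_of_nonneg fun _ => sq_nonneg _
      have h2 : (M : ℝ) ≤ N := by exact_mod_cast (Nat.le_mul_of_pos_right M hk).trans hMN
      simp
      linarith
    have hdiff : S v - S (r • (v : EuclideanSpace ℝ (Fin N))) ≤
        ∑ i : Fin M, lam * (L * (ε * (1 + ∑ j, (v : EuclideanSpace ℝ (Fin N)) (e (i, j)) ^ 2))) := by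
      simp only [S]
      rw [← Finset.sum_sub_distrib]
      refine Finset.sum_le_sum fun i _ => ?_
      rw [← mul_sub]
      refine mul_le_mul_of_nonneg_left ?_ hlam.le
      have := hblock i
      simp only [PiLp.smul_apply, smul_eq_mul]
      linarith
    rw [← Finset.mul_sum, ← Finset.mul_sum, ← Finset.mul_sum] at hdiff
    have h3 : lam * (L * (ε * ∑ i : Fin M,
        (1 + ∑ j, (v : EuclideanSpace ℝ (Fin N)) (e (i, j)) ^ 2))) ≤
        lam * (L * (ε * (2 * N))) := by gcongr
    linarith
  have htrans := hf.condTensor_transfer hN hmass hS hosc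
  have hhoeff : ∫⁻ y, ENNReal.ofReal (Real.exp (S (WithLp.toLp 2 y)))
      ∂(Measure.pi fun _ : Fin N => lineMeasure f) ≤
      ENNReal.ofReal (Real.exp (M * (B ^ 2 * lam ^ 2 / 2))) := by
    have h1 := integral_exp_sum_blocks (lineMeasure f) he
      (h := fun z => lam * (g z - m)) (by fun_prop)
    simp only [S]
    rw [h1, Real.exp_nat_mul, ENNReal.ofReal_pow (Real.exp_pos _).le]
    gcongr
    -- Hoeffding's lemma: values in an interval of length `2 * B` give variance proxy `B ^ 2`.
    have hsub := ProbabilityTheory.hasSubgaussianMGF_of_mem_Icc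
      (μ := Measure.pi fun _ : Fin k => lineMeasure f) (X := g) (a := -B) (b := B)
      hgc.measurable.aemeasurable (ae_of_all _ fun z => abs_le.mp (hB z))
    rw [← ofReal_integral_eq_lintegral_ofReal (hsub.integrable_exp_mul lam)
      (ae_of_all _ fun _ => (Real.exp_pos _).le)]
    refine ENNReal.ofReal_le_ofReal ((hsub.mgf_le lam).trans (le_of_eq ?_))
    congr 2
    have hB0 : 0 ≤ B := (abs_nonneg _).trans (hB 0)
    simp [Real.norm_of_nonneg (by linarith : 0 ≤ B + B)]
  have hfin := ENNReal.ofReal_le_ofReal hjensen |>.trans (htrans.trans (mul_le_mul_right hhoeff _))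
  rw [← ENNReal.ofReal_mul (by positivity), ENNReal.ofReal_le_ofReal_iff (by positivity)] at hfin
  have hlog := Real.log_le_log (Real.exp_pos _) hfin
  rw [Real.log_exp, Real.log_mul (by positivity) (by positivity), Real.log_exp,
    Real.log_mul (by norm_num) (by positivity), Real.log_exp, hmean] at hlog
  linarith

/-- The parameters are fixed in the order `lam`, `ε`, `N`. After division by `lam * M`, the
Hoeffding term, the shell error and the `log 2` term are each at most `η / 4`. -/
theorem eventually_integral_firstCoords_le (hf : RadialDensity f K) {k : ℕ} (hk : 1 ≤ k)
    {g : (Fin k → ℝ) → ℝ} {L : NNReal} (hL : LipschitzWith L g) {B : ℝ} (hB : ∀ z, |g z| ≤ B)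
    {η : ℝ} (hη : 0 < η) : ∀ᶠ N : ℕ in atTop,
      ∫ v, g (firstCoords k N v) ∂(densityMeasure N (condTensor f N)) ≤
        ∫ z, g z ∂(Measure.pi fun _ : Fin k => lineMeasure f) + η := by
  have hK := hf.nonneg_const
  have hk' : (0 : ℝ) < k := by exact_mod_cast hk
  set lam := η / (2 * (B ^ 2 + 1))
  have hlam : 0 < lam := by positivity
  have hB2 : B ^ 2 * lam ≤ η / 2 := by
    have : lam * (B ^ 2 + 1) = η / 2 := by
      simp only [lam]
      field_simp
    linarith
  set ε := η * lam / (16 * k * (lam * L + K + 1))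
  have hden : 0 < lam * L + K + 1 := by positivity
  have hε : 0 < ε := by positivity
  have hε2 : 4 * k * ε * (lam * L + K) ≤ lam * η / 4 := by
    have : 16 * k * ε * (lam * L + K + 1) = η * lam := by
      simp only [ε]
      field_simp
    have h0 : 0 < k * ε := by positivity
    linarith
  have hlim : Tendsto (fun N : ℕ => ((N / k : ℕ) : ℝ)) atTop atTop :=
    tendsto_natCast_atTop_atTop.comp (Nat.tendsto_div_const_atTop (by omega))
  filter_upwards [hf.shell_mass hε, eventually_ge_atTop k,
    hlim.eventually_ge_atTop (4 * Real.log 2 / (lam * η))] with N hmass hN hM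
  have hM1 : 1 ≤ N / k := (Nat.one_le_div_iff (by omega)).mpr hN
  have hmain := hf.integral_firstCoords_le hk hM1 (Nat.div_mul_le_self N k) hmass hL hB hlam
  set M := N / k
  have hM' : (0 : ℝ) < M := by exact_mod_cast hM1
  -- The fewer than `k` coordinates left outside the blocks at most double the count, as `M ≥ 1`.
  have hNM : (N : ℝ) ≤ 2 * k * M := by
    have h1 : N < k * M + k := by
      have := Nat.lt_mul_div_succ N (show 0 < k by omega)
      rwa [Nat.mul_add, Nat.mul_one] at this
    have h2 : k ≤ k * M := Nat.le_mul_of_pos_right k hM1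
    have h3 : N ≤ 2 * k * M := by
      rw [mul_assoc]
      omega
    exact_mod_cast h3
  rw [div_le_iff₀ (by positivity)] at hM
  have h1 : ε * (lam * L + K) * N ≤ ε * (lam * L + K) * (2 * k * M) := by gcongr
  have h2 : 4 * k * ε * (lam * L + K) * M ≤ lam * η / 4 * M := by gcongr
  have h3 : B ^ 2 * lam * (lam * M) ≤ η / 2 * (lam * M) := by gcongr
  have h4 : lam * M * (∫ v, g (firstCoords k N v) ∂(densityMeasure N (condTensor f N)) -
        ∫ z, g z ∂(Measure.pi fun _ : Fin k => lineMeasure f)) ≤ lam * M * η := by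
    refine hmain.trans ?_
    have h5 : 0 < M * (lam * η) := by positivity
    linarith
  have h6 := le_of_mul_le_mul_left h4 (by positivity)
  linarith

/-- The marginals of the conditioned tensor products converge weakly to the tensor products. -/
theorem tendsto_integral_firstCoords (hf : RadialDensity f K) {k : ℕ} (hk : 1 ≤ k)
    (χ : (Fin k → ℝ) →ᵇ ℝ) :
    Tendsto (fun N : ℕ => ∫ v, χ (firstCoords k N v) ∂(densityMeasure N (condTensor f N))) atTop
      (𝓝 (∫ z, χ z ∂(Measure.pi fun _ : Fin k => lineMeasure f))) := by
  have := hf.isProbabilityMeasure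
  -- The index is shifted by one because a probability measure is only available for `N ≥ 1`.
  have hp := fun N : ℕ => hf.isProbabilityMeasure_densityMeasure (Nat.le_add_left 1 N)
  have hmeas := fun N : ℕ => (continuous_firstCoords k (N + 1)).measurable.aemeasurable
    (μ := densityMeasure (N + 1) (condTensor f (N + 1)))
  set μs : ℕ → ProbabilityMeasure (Fin k → ℝ) := fun N =>
    ⟨Measure.map (firstCoords k (N + 1)) (densityMeasure (N + 1) (condTensor f (N + 1))),
      Measure.isProbabilityMeasure_map (hmeas N)⟩
  set μ : ProbabilityMeasure (Fin k → ℝ) := ⟨Measure.pi fun _ : Fin k => lineMeasure f,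
    inferInstance⟩
  have hμs : ∀ (g : (Fin k → ℝ) → ℝ), Continuous g → ∀ N, ∫ z, g z ∂(μs N : Measure _) =
      ∫ v, g (firstCoords k (N + 1) v) ∂(densityMeasure (N + 1) (condTensor f (N + 1))) :=
    fun g hg N => integral_map (hmeas N) hg.aestronglyMeasurable
  have hweak : Tendsto μs atTop (𝓝 μ) := by
    -- Bounded Lipschitz functions determine weak convergence, and the one-sided estimate applied to
    -- both `g` and `-g` gives the limit.
    rw [tendsto_iff_forall_lipschitz_integral_tendsto]
    rintro g ⟨C, hC⟩ ⟨L, hL⟩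
    simp only [hμs g hL.continuous]
    refine (tendsto_add_atTop_iff_nat (f := fun N : ℕ =>
      ∫ v, g (firstCoords k N v) ∂(densityMeasure N (condTensor f N))) 1).mpr ?_
    have hB : ∀ z, |g z| ≤ C + |g 0| := fun z => by
      have := hC z 0
      rw [Real.dist_eq] at this
      linarith [abs_sub_abs_le_abs_sub (g z) (g 0)]
    rw [Metric.tendsto_atTop']
    intro η hη
    have h1 := hf.eventually_integral_firstCoords_le hk hL hB (half_pos hη)
    have h2 := hf.eventually_integral_firstCoords_le hk hL.neg (B := C + |g 0|)
      (fun z => by simpa using hB z) (half_pos hη)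
    obtain ⟨n, hn⟩ := eventually_atTop.mp (h1.and h2)
    refine ⟨n, fun N hN => ?_⟩
    obtain ⟨h3, h4⟩ := hn N hN.le
    simp only [Pi.neg_apply, integral_neg] at h4
    rw [Real.dist_eq, abs_lt]
    change _ < _ - (∫ z, g z ∂(Measure.pi fun _ : Fin k => lineMeasure f)) ∧
      _ - (∫ z, g z ∂(Measure.pi fun _ : Fin k => lineMeasure f)) < _
    constructor <;> linarith
  have h := (ProbabilityMeasure.tendsto_iff_forall_integral_tendsto.mp hweak) χ
  simp only [hμs χ χ.continuous] at h
  exact (tendsto_add_atTop_iff_nat (f := fun N : ℕ =>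
      ∫ v, χ (firstCoords k N v) ∂(densityMeasure N (condTensor f N))) 1).mp h

theorem isChaotic (hf : RadialDensity f K) :
    IsChaotic (lineMeasure f) fun N => densityMeasure N (condTensor f N) :=
  ⟨fun _ hN => hf.isProbabilityMeasure_densityMeasure hN,
    fun _ _ π => map_permute_densityMeasure hf.cont π,
    fun _ hk χ => hf.tendsto_integral_firstCoords hk χ⟩

end RadialDensity

/-! ### Test functions of quadratic growth -/

/-- Continuous functions of at most quadratic growth. -/
def QuadraticGrowth {k : ℕ} (g : (Fin k → ℝ) → ℝ) : Prop :=
  Continuous g ∧ ∃ C, ∀ z, |g z| ≤ C * (1 + ∑ j, z j ^ 2)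

namespace RadialDensity

variable {f g : ℝ → ℝ} {K K' : ℝ}

theorem integrable_sq (hf : RadialDensity f K) : Integrable (fun v => v ^ 2) (lineMeasure f) := by
  simpa using hf.integrable_abs_pow 2

theorem integral_sq (hf : RadialDensity f K) : ∫ v, v ^ 2 ∂(lineMeasure f) = 1 := by
  rw [hf.integral_lineMeasure, hf.second]

theorem integrable_sum_sq (hf : RadialDensity f K) (k : ℕ) :
    Integrable (fun z : Fin k → ℝ => ∑ j, z j ^ 2) (Measure.pi fun _ => lineMeasure f) := by
  have := hf.isProbabilityMeasure
  exact integrable_finsetSum _ fun j _ =>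
    integrable_comp_eval (μ := fun _ : Fin k => lineMeasure f) (f := fun v => v ^ 2) hf.integrable_sq

theorem integral_sum_sq (hf : RadialDensity f K) (k : ℕ) :
    ∫ z : Fin k → ℝ, ∑ j, z j ^ 2 ∂(Measure.pi fun _ => lineMeasure f) = k := by
  have := hf.isProbabilityMeasure
  rw [integral_finsetSum _ fun j _ => integrable_comp_eval
    (μ := fun _ : Fin k => lineMeasure f) (f := fun v => v ^ 2) hf.integrable_sq]
  have : ∀ j : Fin k, ∫ z : Fin k → ℝ, z j ^ 2 ∂(Measure.pi fun _ => lineMeasure f) = 1 :=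
    fun j => (integral_comp_eval (μ := fun _ : Fin k => lineMeasure f)
      (f := fun v : ℝ => v ^ 2) (by fun_prop)).trans hf.integral_sq
  simp [this]

/-- Exchangeability makes the `N` second moments equal, and they add up to the conserved energy `N`.
-/
theorem integral_sq_densityMeasure (hf : RadialDensity f K) {N : ℕ} (i : Fin N) :
    ∫ v : KacSphere N, (v : EuclideanSpace ℝ (Fin N)) i ^ 2
      ∂(densityMeasure N (condTensor f N)) = 1 := by
  have hN : 1 ≤ N := i.pos
  have := hf.isProbabilityMeasure_densityMeasure hN
  have hall : ∀ j : Fin N, ∫ v : KacSphere N, (v : EuclideanSpace ℝ (Fin N)) j ^ 2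
      ∂(densityMeasure N (condTensor f N)) =
      ∫ v, (firstCoords 1 N v) 0 ^ 2 ∂(densityMeasure N (condTensor f N)) := fun j =>
    hf.integral_marginal hN (e := fun _ : Fin 1 => j) (Function.injective_of_subsingleton _)
      (g := fun z => z 0 ^ 2) (by fun_prop)
  have hsum : ∑ j : Fin N, ∫ v : KacSphere N, (v : EuclideanSpace ℝ (Fin N)) j ^ 2
      ∂(densityMeasure N (condTensor f N)) = N := by
    rw [← integral_finsetSum _ fun j _ => integrable_of_continuous (by fun_prop)]
    simp only [sum_sq_kacSphere]
    simp
  have hN' : (N : ℝ) ≠ 0 := by exact_mod_cast (by omega : N ≠ 0)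
  simp only [hall] at hsum ⊢
  simpa [hN'] using hsum

theorem integral_sum_sq_firstCoords (hf : RadialDensity f K) {k N : ℕ} (hN : 1 ≤ N) (hk : k ≤ N) :
    ∫ v, ∑ j, firstCoords k N v j ^ 2 ∂(densityMeasure N (condTensor f N)) = k := by
  have := hf.isProbabilityMeasure_densityMeasure hN
  simp only [firstCoords_eq hk]
  rw [integral_finsetSum _ fun j _ => integrable_of_continuous (by fun_prop)]
  simp [hf.integral_sq_densityMeasure]

theorem integrable_of_quadraticGrowth (hf : RadialDensity f K) {k : ℕ} {g : (Fin k → ℝ) → ℝ}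
    (hg : QuadraticGrowth g) : Integrable g (Measure.pi fun _ => lineMeasure f) := by
  have := hf.isProbabilityMeasure
  obtain ⟨hgc, C, hC⟩ := hg
  refine Integrable.mono' (((integrable_const 1).add (hf.integrable_sum_sq k)).const_mul C)
    hgc.aestronglyMeasurable (ae_of_all _ fun z => ?_)
  exact hC z

/-- Lower semicontinuity along the chaotic sequence for functions of quadratic growth: the second
moments converge, so no mass of `g⁻` is lost. -/
theorem eventually_le_integral_firstCoords (hf : RadialDensity f K) {k : ℕ} (hk : 1 ≤ k)
    {g : (Fin k → ℝ) → ℝ} (hg : QuadraticGrowth g) {η : ℝ} (hη : 0 < η) : ∀ᶠ N : ℕ in atTop,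
      ∫ z, g z ∂(Measure.pi fun _ : Fin k => lineMeasure f) - η ≤
        ∫ v, g (firstCoords k N v) ∂(densityMeasure N (condTensor f N)) := by
  have := hf.isProbabilityMeasure
  have hgi := hf.integrable_of_quadraticGrowth hg
  obtain ⟨hgc, C, hC⟩ := hg
  -- The weight `w` makes `g + w` nonnegative, so truncating it from above only lowers the integral.
  -- Its own mean is `C * (1 + k)` under the marginal as well as under the limit, so it cancels at
  -- the end.
  set w : (Fin k → ℝ) → ℝ := fun z => C * (1 + ∑ j, z j ^ 2)
  have hwc : Continuous w := by fun_prop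
  have hwi : Integrable w (Measure.pi fun _ => lineMeasure f) :=
    ((integrable_const 1).add (hf.integrable_sum_sq k)).const_mul C
  have hw : ∫ z, w z ∂(Measure.pi fun _ : Fin k => lineMeasure f) = C * (1 + k) := by
    simp only [w]
    rw [integral_const_mul, integral_add (integrable_const _) (hf.integrable_sum_sq k),
      hf.integral_sum_sq]
    simp
  have h0 : ∀ z, 0 ≤ g z + w z := fun z => by linarith [neg_abs_le (g z), hC z]
  have htrunc : Tendsto (fun n : ℕ => ∫ z, min (g z + w z) n
      ∂(Measure.pi fun _ : Fin k => lineMeasure f)) atTop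
      (𝓝 (∫ z, (g z + w z) ∂(Measure.pi fun _ : Fin k => lineMeasure f))) := by
    refine tendsto_integral_of_dominated_convergence (fun z => g z + w z)
      (fun n => by fun_prop) (hgi.add hwi) (fun n => ae_of_all _ fun z => ?_)
      (ae_of_all _ fun z => ?_)
    · rw [Real.norm_of_nonneg (le_min (h0 z) (Nat.cast_nonneg n))]
      exact min_le_left _ _
    · refine tendsto_const_nhds.congr' ?_
      filter_upwards [eventually_ge_atTop ⌈g z + w z⌉₊] with n hn
      exact (min_eq_left ((Nat.le_ceil _).trans (by exact_mod_cast hn))).symm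
  obtain ⟨n, hn⟩ := (htrunc.eventually_const_lt (sub_lt_self _ (half_pos hη))).exists
  set χ : (Fin k → ℝ) →ᵇ ℝ := BoundedContinuousFunction.ofNormedAddCommGroup
    (fun z => min (g z + w z) n) (by fun_prop) n fun z => by
      rw [Real.norm_of_nonneg (le_min (h0 z) (Nat.cast_nonneg n))]
      exact min_le_right _ _
  filter_upwards [(hf.tendsto_integral_firstCoords hk χ).eventually_const_lt
    (sub_lt_self _ (half_pos hη)), eventually_ge_atTop k] with N hN hkN
  have hN1 := hk.trans hkN
  have := hf.isProbabilityMeasure_densityMeasure hN1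
  have hfc := continuous_firstCoords k N
  have hle : ∫ v, χ (firstCoords k N v) ∂(densityMeasure N (condTensor f N)) ≤
      ∫ v, (g (firstCoords k N v) + w (firstCoords k N v))
        ∂(densityMeasure N (condTensor f N)) :=
    integral_mono (integrable_of_continuous (by fun_prop)) (integrable_of_continuous (by fun_prop))
      fun v => min_le_left _ _
  have hwN : ∫ v, w (firstCoords k N v) ∂(densityMeasure N (condTensor f N)) = C * (1 + k) := by
    simp only [w]
    rw [integral_const_mul, integral_add (integrable_const _)
      (integrable_of_continuous (by fun_prop)), hf.integral_sum_sq_firstCoords hN1 hkN]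
    simp
  rw [integral_add (integrable_of_continuous (by fun_prop))
    (integrable_of_continuous (by fun_prop)), hwN] at hle
  rw [integral_add hgi hwi, hw] at hn
  have hχ : ∫ z, χ z ∂(Measure.pi fun _ : Fin k => lineMeasure f) =
    ∫ z, min (g z + w z) n ∂(Measure.pi fun _ : Fin k => lineMeasure f) := rfl
  linarith

/-- Every real number is `0` or a positive multiple of `1` or `-1`. The scaling bound, read from
these base points in both directions, gives quadratic growth. -/
theorem log_growth (hf : RadialDensity f K) : ∃ C, ∀ v, |Real.log (f v)| ≤ C * (1 + v ^ 2) := by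
  have hK := hf.nonneg_const
  set A := |Real.log (f 0)| + |Real.log (f 1)| + |Real.log (f (-1))|
  have key : ∀ s r : ℝ, 0 < r → |Real.log (f (r * s))| ≤
      K * |r ^ 2 - 1| * s ^ 2 + |Real.log (f s)| := by
    intro s r hr
    have h1 := Real.log_le_log (hf.pos _) (hf.scale r s hr)
    have h2 := Real.log_le_log (hf.pos _) (hf.le_scale r s hr)
    rw [Real.log_mul (Real.exp_pos _).ne' (hf.pos _).ne', Real.log_exp] at h1 h2
    rw [abs_le]
    constructor <;> linarith [neg_abs_le (Real.log (f s)), le_abs_self (Real.log (f s))]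
  have hA0 : 0 ≤ A := by positivity
  refine ⟨K + A, fun v => ?_⟩
  have hv1 : |v ^ 2 - 1| ≤ 1 + v ^ 2 := by
    rw [abs_le]
    constructor <;> linarith [sq_nonneg v]
  have hAv : 0 ≤ A * v ^ 2 := by positivity
  have hKv : K * |v ^ 2 - 1| ≤ K * (1 + v ^ 2) := by gcongr
  have hsum := abs_nonneg (Real.log (f 0))
  have hsum1 := abs_nonneg (Real.log (f 1))
  have hsum2 := abs_nonneg (Real.log (f (-1)))
  rcases lt_trichotomy v 0 with hv | rfl | hv
  · have h := key (-1) (-v) (neg_pos.mpr hv)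
    simp only [mul_neg, mul_one, neg_neg, even_two, Even.neg_pow, one_pow] at h
    simp only [A] at hAv ⊢
    linarith
  · simp only [A]
    norm_num
    linarith
  · have h := key 1 v hv
    simp only [mul_one, one_pow] at h
    simp only [A] at hAv ⊢
    linarith

/-! ### Entropy and normalization of the conditioned tensor product -/

theorem log_condTensor (hf : RadialDensity f K) {N : ℕ} (hN : 1 ≤ N) (v : KacSphere N) :
    Real.log (condTensor f N v) =
      ∑ j, Real.log (f ((v : EuclideanSpace ℝ (Fin N)) j)) - Real.log (Z N f) := by
  rw [condTensor, Real.log_div (Finset.prod_pos fun j _ => hf.pos _).ne' (hf.Z_pos hN).ne',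
    Real.log_prod fun j _ => (hf.pos _).ne']

theorem continuous_log (hf : RadialDensity f K) : Continuous fun v => Real.log (f v) :=
  hf.cont.log fun v => (hf.pos v).ne'

theorem continuous_log_condTensor (hf : RadialDensity f K) {N : ℕ} (hN : 1 ≤ N) :
    Continuous fun v => Real.log (condTensor f N v) :=
  (hf.continuous_condTensor N).log fun v => (hf.condTensor_pos hN v).ne'

/-- The relative entropy of the conditioned tensor product. -/
theorem entropy_condTensor (hf : RadialDensity f K) {N : ℕ} (hN : 1 ≤ N) :
    entropy N (condTensor f N) = ENNReal.ofReal
      (∫ v, Real.log (condTensor f N v) ∂(densityMeasure N (condTensor f N))) := by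
  have := isProbabilityMeasure_sigma hN
  have := hf.isProbabilityMeasure_densityMeasure hN
  have hac : densityMeasure N (condTensor f N) ≪ sigma N := withDensity_absolutelyContinuous _ _
  have hllr : llr (densityMeasure N (condTensor f N)) (sigma N)
      =ᵐ[densityMeasure N (condTensor f N)] fun v => Real.log (condTensor f N v) := by
    refine hac.ae_le ?_
    filter_upwards [Measure.rnDeriv_withDensity (sigma N)
      (hf.continuous_condTensor N).measurable.ennreal_ofReal] with v hv
    rw [llr, densityMeasure, hv, ENNReal.toReal_ofReal (hf.condTensor_pos hN v).le]
  rw [entropy, InformationTheory.klDiv_of_ac_of_integrable hac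
    ((integrable_congr hllr).mpr (integrable_of_continuous (hf.continuous_log_condTensor hN))),
    integral_congr_ae hllr]
  simp

theorem integral_log_condTensor (hf : RadialDensity f K) {N : ℕ} (hN : 1 ≤ N) :
    ∫ v, Real.log (condTensor f N v) ∂(densityMeasure N (condTensor f N)) =
      N * ∫ v, Real.log (f (firstCoords 1 N v 0)) ∂(densityMeasure N (condTensor f N)) -
        Real.log (Z N f) := by
  have := hf.isProbabilityMeasure_densityMeasure hN
  have hl := hf.continuous_log
  have hall : ∀ j : Fin N, ∫ v : KacSphere N, Real.log (f ((v : EuclideanSpace ℝ (Fin N)) j))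
      ∂(densityMeasure N (condTensor f N)) =
      ∫ v, Real.log (f (firstCoords 1 N v 0)) ∂(densityMeasure N (condTensor f N)) := fun j =>
    hf.integral_marginal hN (e := fun _ : Fin 1 => j) (Function.injective_of_subsingleton _)
      (g := fun z => Real.log (f (z 0))) (hl.comp (continuous_apply 0))
  have hi : ∀ j : Fin N, Integrable (fun v : KacSphere N =>
      Real.log (f ((v : EuclideanSpace ℝ (Fin N)) j))) (densityMeasure N (condTensor f N)) :=
    fun j => integrable_of_continuous
      (hl.comp (by fun_prop : Continuous fun v : KacSphere N => (v : EuclideanSpace ℝ (Fin N)) j))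
  simp only [hf.log_condTensor hN]
  rw [integral_sub (integrable_finsetSum _ fun j _ => hi j) (integrable_const _),
    integral_finsetSum _ fun j _ => hi j]
  simp [hall]

/-- Comparison of the normalizations of two tensor products. -/
theorem log_Z_le (hf : RadialDensity f K) (hg : RadialDensity g K') {N : ℕ} (hN : 1 ≤ N) {ε : ℝ}
    (hmass : 2⁻¹ ≤ ∫⁻ x in shell N ε, ENNReal.ofReal (∏ j, g (x j))) :
    Real.log (Z N f) ≤ Real.log 2 + (K + K') * ε * N + Real.log (Z N g) := by
  have := isProbabilityMeasure_sigma hN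
  have := hf.isProbabilityMeasure
  have hc := hf.cont
  have hc' := hg.cont
  have hZf := hf.Z_pos hN
  have hZg := hg.Z_pos hN
  have eZ : ∀ {h : ℝ → ℝ} {κ : ℝ}, RadialDensity h κ → ∫⁻ v : KacSphere N,
      ENNReal.ofReal (∏ j, h ((v : EuclideanSpace ℝ (Fin N)) j)) ∂(sigma N) =
        ENNReal.ofReal (Z N h) := fun hh =>
    (ofReal_integral_eq_lintegral_ofReal (integrable_of_continuous (hh.continuous_prod N))
      (ae_of_all _ fun _ => Finset.prod_nonneg fun _ _ => (hh.pos _).le)).symm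
  -- The shell comparison is used across two densities: the whole mass of `f^{⊗N}`, which is `1`,
  -- bounds one side, and the shell mass of `g^{⊗N}` the other. The factor `1 *` in `Φ'` matches the
  -- form of `lintegral_pi`.
  have key := shell_transfer (ε := ε) hN
    (Φ := fun x => ENNReal.ofReal (∏ j, f (x j)))
    (Φ' := fun x => 1 * ENNReal.ofReal (∏ j, f (x j)))
    (Ψ := fun x => ENNReal.ofReal (∏ j, g (x j)))
    (A := ENNReal.ofReal (Real.exp (K * ε * N))) (B := ENNReal.ofReal (Real.exp (K' * ε * N)))
    (by fun_prop) (by fun_prop) (by fun_prop)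
    (fun v r hr hε => by
      rw [one_mul, ← ENNReal.ofReal_mul (Real.exp_pos _).le]
      exact ENNReal.ofReal_le_ofReal (hf.prod_le_scale hr hε v))
    (fun v r hr hε => by
      rw [← ENNReal.ofReal_mul (Real.exp_pos _).le]
      exact ENNReal.ofReal_le_ofReal (hg.prod_scale_le hr hε v))
  rw [eZ hf, eZ hg, hf.lintegral_pi N measurable_const, lintegral_one, measure_univ, mul_one,
    ← ENNReal.ofReal_mul (Real.exp_pos _).le, ← ENNReal.ofReal_mul (by positivity)] at key
  have h2 : (2⁻¹ : ℝ≥0∞) = ENNReal.ofReal 2⁻¹ := by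
    rw [ENNReal.ofReal_inv_of_pos (by norm_num)]
    norm_num
  have hfin : ENNReal.ofReal (2⁻¹ * Z N f) ≤
      ENNReal.ofReal (Real.exp (K' * ε * N) * Z N g * Real.exp (K * ε * N)) := by
    rw [ENNReal.ofReal_mul (by norm_num), ← h2]
    exact (mul_le_mul_left hmass _).trans key
  rw [ENNReal.ofReal_le_ofReal_iff (by positivity)] at hfin
  have hlog := Real.log_le_log (by positivity) hfin
  rw [Real.log_mul (by norm_num) hZf.ne', Real.log_mul (by positivity) (by positivity),
    Real.log_mul (by positivity) hZg.ne', Real.log_exp, Real.log_exp, Real.log_inv] at hlog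
  linarith

end RadialDensity

/-! ### Collisions and the entropy production -/

/-- The rotation `R_{i,j,θ}` as a linear isometry. -/
def rotIso {N : ℕ} {i j : Fin N} (hij : i ≠ j) (θ : ℝ) :
    EuclideanSpace ℝ (Fin N) ≃ₗᵢ[ℝ] EuclideanSpace ℝ (Fin N) where
  toFun := rotVec i j θ
  invFun := rotVec i j (-θ)
  map_add' x y := by
    ext k
    simp only [rotVec, PiLp.add_apply]
    split_ifs <;> ring
  map_smul' c x := by
    ext k
    simp only [rotVec, PiLp.smul_apply, smul_eq_mul, RingHom.id_apply]
    split_ifs <;> ring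
  left_inv x := by
    ext k
    have h := Real.sin_sq_add_cos_sq θ
    simp only [rotVec, Real.cos_neg, Real.sin_neg, if_true, if_neg hij.symm]
    split_ifs with h1 h2
    · subst h1
      linear_combination x k * h
    · subst h2
      linear_combination x k * h
    · rfl
  right_inv x := by
    ext k
    have h := Real.sin_sq_add_cos_sq θ
    simp only [rotVec, Real.cos_neg, Real.sin_neg, if_true, if_neg hij.symm]
    split_ifs with h1 h2
    · subst h1
      linear_combination x k * h
    · subst h2
      linear_combination x k * h
    · rfl
  norm_map' x := norm_rotVec hij θ x

theorem sphereMap_rotIso {N : ℕ} (p : {p : Fin N × Fin N // p.1 < p.2}) (θ : ℝ) :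
    sphereMap (rotIso p.2.ne θ) = rot p θ := rfl

theorem rot_rot_neg {N : ℕ} (p : {p : Fin N × Fin N // p.1 < p.2}) (θ : ℝ) (v : KacSphere N) :
    rot p θ (rot p (-θ) v) = v :=
  Subtype.ext ((rotIso p.2.ne θ).right_inv v)

theorem integral_comp_rot {N : ℕ} (p : {p : Fin N × Fin N // p.1 < p.2}) (θ : ℝ)
    {h : KacSphere N → ℝ} (hh : Continuous h) :
    ∫ v, h (rot p θ v) ∂(sigma N) = ∫ v, h v ∂(sigma N) := by
  have hT := measurePreserving_sphereMap (rotIso p.2.ne θ)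
  rw [sphereMap_rotIso] at hT
  conv_rhs => rw [← hT.map_eq]
  rw [integral_map hT.measurable.aemeasurable hh.aestronglyMeasurable]

theorem continuous_rot {N : ℕ} (p : {p : Fin N × Fin N // p.1 < p.2}) :
    Continuous fun q : KacSphere N × ℝ => rot p q.2 q.1 := by
  refine Continuous.subtype_mk ?_ _
  refine (PiLp.continuous_toLp 2 _).comp (continuous_pi fun k => ?_)
  split_ifs <;> fun_prop

/-- Exchange of the angular average with an integral over the sphere. -/
theorem integral_intervalIntegral_swap {N : ℕ} (μ : Measure (KacSphere N)) [IsFiniteMeasure μ]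
    {h : KacSphere N → ℝ → ℝ} (hh : Continuous (Function.uncurry h)) (a b : ℝ) :
    ∫ v, (∫ θ in a..b, h v θ) ∂μ = ∫ θ in a..b, (∫ v, h v θ ∂μ) := by
  refine (intervalIntegral_integral_swap (f := fun θ v => h v θ) ?_).symm
  have hc : Continuous (Function.uncurry fun θ v => h v θ) := hh.comp continuous_swap
  have hcomp : IsCompact (Set.uIcc a b ×ˢ (Set.univ : Set (KacSphere N))) :=
    isCompact_uIcc.prod isCompact_univ
  have hi := (hc.continuousOn.integrableOn_compact (μ := volume.prod μ) hcomp).mono_set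
    (Set.prod_mono_left Set.uIoc_subset_uIcc)
  rwa [IntegrableOn, ← Measure.prod_restrict, Measure.restrict_univ] at hi

/-- The loss of `log f ⊗ f` in a collision of angle `θ`. -/
def collisionLoss (f : ℝ → ℝ) (x y θ : ℝ) : ℝ :=
  Real.log (f x) + Real.log (f y) - Real.log (f (Real.cos θ * x + Real.sin θ * y)) -
    Real.log (f (-Real.sin θ * x + Real.cos θ * y))

/-- The angular average of the loss. -/
def meanCollisionLoss (f : ℝ → ℝ) (z : Fin 2 → ℝ) : ℝ :=
  (2 * Real.pi)⁻¹ * ∫ θ in (0 : ℝ)..(2 * Real.pi), collisionLoss f (z 0) (z 1) θ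

namespace RadialDensity

variable {f : ℝ → ℝ} {K : ℝ}

theorem continuous_collisionLoss (hf : RadialDensity f K) :
    Continuous fun q : (ℝ × ℝ) × ℝ => collisionLoss f q.1.1 q.1.2 q.2 := by
  have hl := hf.continuous_log
  unfold collisionLoss
  refine ((Continuous.add ?_ ?_).sub ?_).sub ?_
  · exact hl.comp (by fun_prop)
  · exact hl.comp (by fun_prop)
  · exact hl.comp (by fun_prop)
  · exact hl.comp (by fun_prop)

/-- A collision conserves `x ^ 2 + y ^ 2`, so the outgoing logarithms obey the same quadratic bound
as the incoming ones, uniformly in the angle. -/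
theorem collisionLoss_growth (hf : RadialDensity f K) :
    ∃ C, ∀ x y θ, |collisionLoss f x y θ| ≤ C * (1 + (x ^ 2 + y ^ 2)) := by
  obtain ⟨C, hC⟩ := hf.log_growth
  refine ⟨4 * C, fun x y θ => ?_⟩
  have hC0 : 0 ≤ C := by simpa using (abs_nonneg _).trans (hC 0)
  have h1 := hC x
  have h2 := hC y
  have h3 := hC (Real.cos θ * x + Real.sin θ * y)
  have h4 := hC (-Real.sin θ * x + Real.cos θ * y)
  have h5 : C * (Real.cos θ * x + Real.sin θ * y) ^ 2 +
      C * (-Real.sin θ * x + Real.cos θ * y) ^ 2 = C * (x ^ 2 + y ^ 2) := by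
    linear_combination C * (x ^ 2 + y ^ 2) * Real.sin_sq_add_cos_sq θ
  have h6 : 0 ≤ C * (x ^ 2 + y ^ 2) := by positivity
  rw [collisionLoss]
  rw [abs_le] at h1 h2 h3 h4 ⊢
  constructor <;> linarith [h1.1, h1.2]

theorem quadraticGrowth_meanCollisionLoss (hf : RadialDensity f K) :
    QuadraticGrowth (meanCollisionLoss f) := by
  have hc := hf.continuous_collisionLoss
  constructor
  · unfold meanCollisionLoss
    refine continuous_const.mul (intervalIntegral.continuous_parametric_intervalIntegral_of_continuous'
      (f := fun (z : Fin 2 → ℝ) θ => collisionLoss f (z 0) (z 1) θ) ?_ _ _)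
    exact hc.comp (by fun_prop : Continuous fun q : (Fin 2 → ℝ) × ℝ => ((q.1 0, q.1 1), q.2))
  · obtain ⟨C, hC⟩ := hf.collisionLoss_growth
    refine ⟨C, fun z => ?_⟩
    have hpi := Real.pi_pos
    have := intervalIntegral.norm_integral_le_of_norm_le_const (a := 0) (b := 2 * Real.pi)
      (f := fun θ => collisionLoss f (z 0) (z 1) θ) fun θ _ => hC (z 0) (z 1) θ
    rw [meanCollisionLoss, abs_mul, abs_of_pos (by positivity), inv_mul_le_iff₀ (by positivity),
      Fin.sum_univ_two]
    refine this.trans (le_of_eq ?_)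
    rw [sub_zero, abs_of_pos (by positivity)]
    ring

/-- Both the constant `Z` and the coordinates outside the pair cancel. The angle is `-θ` because the
rotation will be moved from `F` onto `log F` by duality. -/
theorem log_condTensor_rot (hf : RadialDensity f K) {N : ℕ} (hN : 1 ≤ N)
    (p : {p : Fin N × Fin N // p.1 < p.2}) (θ : ℝ) (v : KacSphere N) :
    Real.log (condTensor f N (rot p (-θ) v)) = Real.log (condTensor f N v) -
      collisionLoss f ((v : EuclideanSpace ℝ (Fin N)) p.1.1)
        ((v : EuclideanSpace ℝ (Fin N)) p.1.2) θ := by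
  obtain ⟨⟨i, j⟩, hij⟩ := p
  have hne : i ≠ j := ne_of_lt hij
  have hj : j ∈ Finset.univ.erase i := Finset.mem_erase.mpr ⟨hne.symm, Finset.mem_univ j⟩
  rw [hf.log_condTensor hN, hf.log_condTensor hN]
  rw [← Finset.add_sum_erase _ _ (Finset.mem_univ i), ← Finset.add_sum_erase _ _ hj,
    ← Finset.add_sum_erase _ (fun k => Real.log (f ((v : EuclideanSpace ℝ (Fin N)) k)))
      (Finset.mem_univ i),
    ← Finset.add_sum_erase _ (fun k => Real.log (f ((v : EuclideanSpace ℝ (Fin N)) k))) hj]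
  have hrest : ∑ k ∈ (Finset.univ.erase i).erase j, Real.log (f
      ((rot ⟨(i, j), hij⟩ (-θ) v : EuclideanSpace ℝ (Fin N)) k)) =
      ∑ k ∈ (Finset.univ.erase i).erase j, Real.log (f ((v : EuclideanSpace ℝ (Fin N)) k)) := by
    refine Finset.sum_congr rfl fun k hk => ?_
    have h1 : k ≠ j := Finset.ne_of_mem_erase hk
    have h2 : k ≠ i := Finset.ne_of_mem_erase (Finset.mem_of_mem_erase hk)
    simp only [rot, rotVec, if_neg h1, if_neg h2]
  rw [hrest]
  simp only [rot, rotVec, if_true, if_neg hne.symm, collisionLoss, Real.cos_neg, Real.sin_neg,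
    neg_mul, sub_neg_eq_add]
  ring

theorem continuous_collisionLoss_left (hf : RadialDensity f K) (θ : ℝ) :
    Continuous fun q : ℝ × ℝ => collisionLoss f q.1 q.2 θ :=
  hf.continuous_collisionLoss.comp (Continuous.prodMk_left θ)

/-- The mean loss in a collision of two given particles. -/
theorem integral_collisionLoss (hf : RadialDensity f K) {N : ℕ} (hN : 2 ≤ N)
    {i j : Fin N} (hij : i ≠ j) (θ : ℝ) :
    ∫ v : KacSphere N, collisionLoss f ((v : EuclideanSpace ℝ (Fin N)) i)
        ((v : EuclideanSpace ℝ (Fin N)) j) θ ∂(densityMeasure N (condTensor f N)) =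
      ∫ v, collisionLoss f (firstCoords 2 N v 0) (firstCoords 2 N v 1) θ
        ∂(densityMeasure N (condTensor f N)) := by
  have hinj : Function.Injective ![i, j] := by
    simp [Function.Injective, Fin.forall_fin_two, hij, hij.symm]
  have hc := hf.continuous_collisionLoss_left θ
  have hg : Continuous fun z : Fin 2 → ℝ => (z 0, z 1) := by fun_prop
  exact hf.integral_marginal hN hinj (hc.comp hg)

/-- The pairing of `log F` with a rotated copy of `F`. -/
theorem integral_log_mul_rot (hf : RadialDensity f K) {N : ℕ} (hN : 2 ≤ N)
    (p : {p : Fin N × Fin N // p.1 < p.2}) (θ : ℝ) :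
    ∫ v, Real.log (condTensor f N v) * condTensor f N (rot p θ v) ∂(sigma N) =
      ∫ v, Real.log (condTensor f N v) ∂(densityMeasure N (condTensor f N)) -
      ∫ v, collisionLoss f (firstCoords 2 N v 0) (firstCoords 2 N v 1) θ
        ∂(densityMeasure N (condTensor f N)) := by
  have hN1 : 1 ≤ N := by omega
  have := hf.isProbabilityMeasure_densityMeasure hN1
  have hF := hf.continuous_condTensor N
  have hlog := hf.continuous_log_condTensor hN1
  have hrot : Continuous fun v : KacSphere N => condTensor f N (rot p θ v) := by
    refine hF.comp ?_
    rw [← sphereMap_rotIso]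
    exact continuous_sphereMap _
  have hc := hf.continuous_collisionLoss_left θ
  have hg : Continuous fun v : KacSphere N => ((v : EuclideanSpace ℝ (Fin N)) p.1.1,
    (v : EuclideanSpace ℝ (Fin N)) p.1.2) := by fun_prop
  have hcv : Continuous fun v : KacSphere N => collisionLoss f
      ((v : EuclideanSpace ℝ (Fin N)) p.1.1) ((v : EuclideanSpace ℝ (Fin N)) p.1.2) θ :=
    hc.comp hg
  rw [← hf.integral_collisionLoss hN p.2.ne θ,
    ← integral_sub (integrable_of_continuous hlog) (integrable_of_continuous hcv),
    hf.integral_densityMeasure hN1]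
  -- The substitution `v ↦ R_{i,j,-θ} v` removes the rotation from `F` and places its inverse inside
  -- the logarithm.
  refine (integral_comp_rot p (-θ) (hlog.mul hrot)).symm.trans ?_
  refine integral_congr_ae (ae_of_all _ fun v => ?_)
  simp only [Pi.mul_apply, rot_rot_neg, hf.log_condTensor_rot hN1]
  ring

theorem continuous_Q (hf : RadialDensity f K) (N : ℕ) : Continuous (Q N (condTensor f N)) := by
  unfold Q
  refine continuous_const.mul (continuous_finsetSum _ fun p _ => continuous_const.mul ?_)
  exact intervalIntegral.continuous_parametric_intervalIntegral_of_continuous'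
    (f := fun (v : KacSphere N) θ => condTensor f N (rot p θ v))
    ((hf.continuous_condTensor N).comp (continuous_rot p)) _ _

theorem card_pairs (N : ℕ) : Fintype.card {p : Fin N × Fin N // p.1 < p.2} = N.choose 2 := by
  rw [Fintype.card_subtype, Nat.choose_two_right, ← Finset.sum_range_id,
    Finset.card_eq_sum_card_fiberwise (f := Prod.snd) (t := Finset.univ) fun _ _ => by simp,
    ← Fin.sum_univ_eq_sum_range fun i => i]
  refine Finset.sum_congr rfl fun j _ => ?_
  rw [← Fin.card_Iio j]
  refine Finset.card_bij (fun p _ => p.1) ?_ ?_ ?_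
  · rintro ⟨a, b⟩ h
    simp only [Finset.mem_filter] at h
    simpa [← h.2] using h.1.2
  · rintro ⟨a, b⟩ h ⟨a', b'⟩ h' e
    simp only [Finset.mem_filter] at h h'
    exact Prod.ext e (h.2.trans h'.2.symm)
  · intro a ha
    exact ⟨(a, j), by simpa using ha, rfl⟩

/-- By `integral_log_mul_rot` the contribution of a pair does not depend on the pair, so the average
over all pairs equals a single term. The angular average is exchanged with the integral by Fubini,
all integrands being continuous on compact sets. -/
theorem integral_log_mul_Q (hf : RadialDensity f K) {N : ℕ} (hN : 2 ≤ N) :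
    ∫ v, Real.log (condTensor f N v) * Q N (condTensor f N) v ∂(sigma N) =
      ∫ v, Real.log (condTensor f N v) ∂(densityMeasure N (condTensor f N)) -
      ∫ v, meanCollisionLoss f (firstCoords 2 N v) ∂(densityMeasure N (condTensor f N)) := by
  have hN1 : 1 ≤ N := by omega
  have := isProbabilityMeasure_sigma hN1
  have := hf.isProbabilityMeasure_densityMeasure hN1
  have hF := hf.continuous_condTensor N
  have hlog := hf.continuous_log_condTensor hN1
  have hpi := Real.pi_pos
  set A := ∫ v, Real.log (condTensor f N v) ∂(densityMeasure N (condTensor f N))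
  set D := ∫ v, meanCollisionLoss f (firstCoords 2 N v) ∂(densityMeasure N (condTensor f N))
  have hcF : ∀ p : {p : Fin N × Fin N // p.1 < p.2}, Continuous (Function.uncurry
      fun (v : KacSphere N) θ => Real.log (condTensor f N v) * condTensor f N (rot p θ v)) :=
    fun p => (hlog.comp continuous_fst).mul (hF.comp (continuous_rot p))
  have hcl : Continuous (Function.uncurry fun (v : KacSphere N) θ =>
      collisionLoss f (firstCoords 2 N v 0) (firstCoords 2 N v 1) θ) := by
    have hfc := continuous_firstCoords 2 N
    exact hf.continuous_collisionLoss.comp (by fun_prop : Continuous fun q : KacSphere N × ℝ =>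
      ((firstCoords 2 N q.1 0, firstCoords 2 N q.1 1), q.2))
  have hD : D = (2 * Real.pi)⁻¹ * ∫ θ in (0 : ℝ)..(2 * Real.pi),
      ∫ v, collisionLoss f (firstCoords 2 N v 0) (firstCoords 2 N v 1) θ
        ∂(densityMeasure N (condTensor f N)) := by
    rw [← integral_intervalIntegral_swap _ hcl, ← integral_const_mul]
    rfl
  have hp : ∀ p : {p : Fin N × Fin N // p.1 < p.2},
      ∫ v, Real.log (condTensor f N v) * ((2 * Real.pi)⁻¹ * ∫ θ in (0 : ℝ)..(2 * Real.pi),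
        condTensor f N (rot p θ v)) ∂(sigma N) = A - D := by
    intro p
    have h1 : ∀ v, Real.log (condTensor f N v) * ((2 * Real.pi)⁻¹ *
        ∫ θ in (0 : ℝ)..(2 * Real.pi), condTensor f N (rot p θ v)) =
        (2 * Real.pi)⁻¹ * ∫ θ in (0 : ℝ)..(2 * Real.pi),
          Real.log (condTensor f N v) * condTensor f N (rot p θ v) := fun v => by
      rw [intervalIntegral.integral_const_mul]
      ring
    simp only [h1]
    rw [integral_const_mul, integral_intervalIntegral_swap _ (hcF p)]
    simp only [hf.integral_log_mul_rot hN p]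
    have hci : Continuous fun θ : ℝ => ∫ v, collisionLoss f (firstCoords 2 N v 0)
        (firstCoords 2 N v 1) θ ∂(densityMeasure N (condTensor f N)) := by
      have := continuous_parametric_integral_of_continuous
        (μ := densityMeasure N (condTensor f N)) (f := fun (θ : ℝ) (v : KacSphere N) =>
          collisionLoss f (firstCoords 2 N v 0) (firstCoords 2 N v 1) θ)
        (hcl.comp continuous_swap) isCompact_univ
      simpa only [Measure.restrict_univ] using this
    rw [intervalIntegral.integral_sub (by simp) (hci.intervalIntegrable _ _), mul_sub, ← hD,
      intervalIntegral.integral_const, smul_eq_mul, sub_zero, ← mul_assoc,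
      inv_mul_cancel₀ (by positivity), one_mul]
  have hch : ((N.choose 2 : ℕ) : ℝ) ≠ 0 := by
    exact_mod_cast (Nat.choose_pos hN).ne'
  have h2 : ∀ v, Real.log (condTensor f N v) * Q N (condTensor f N) v =
      ((N.choose 2 : ℕ) : ℝ)⁻¹ * ∑ p : {p : Fin N × Fin N // p.1 < p.2},
        Real.log (condTensor f N v) * ((2 * Real.pi)⁻¹ * ∫ θ in (0 : ℝ)..(2 * Real.pi),
          condTensor f N (rot p θ v)) := fun v => by
    rw [Q, mul_left_comm, Finset.mul_sum]
  simp only [h2]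
  rw [integral_const_mul, integral_finsetSum]
  · simp only [hp, Finset.sum_const, Finset.card_univ, card_pairs, nsmul_eq_mul]
    rw [← mul_assoc, inv_mul_cancel₀ hch, one_mul]
  · intro p _
    refine integrable_of_continuous (hlog.mul (continuous_const.mul ?_))
    exact intervalIntegral.continuous_parametric_intervalIntegral_of_continuous'
      (f := fun (v : KacSphere N) θ => condTensor f N (rot p θ v)) (hF.comp (continuous_rot p)) _ _

/-- The entropy production of the conditioned tensor product is a two-particle quantity. -/
theorem entropyProduction_condTensor (hf : RadialDensity f K) {N : ℕ} (hN : 2 ≤ N) :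
    entropyProduction N (condTensor f N) =
      ((N * ∫ v, meanCollisionLoss f (firstCoords 2 N v)
        ∂(densityMeasure N (condTensor f N)) : ℝ) : EReal) := by
  have hN1 : 1 ≤ N := by omega
  have := isProbabilityMeasure_sigma hN1
  have hF := hf.continuous_condTensor N
  have hQ := hf.continuous_Q N
  have hlog := hf.continuous_log_condTensor hN1
  have hL : Continuous (L N (condTensor f N)) := continuous_const.mul (hQ.sub hF)
  -- The density is positive and continuous on a compact sphere, so its logarithm is continuous and
  -- the value `⊤` does not occur.
  rw [entropyProduction, if_pos ⟨ae_of_all _ fun v => hf.condTensor_pos hN1 v,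
    integrable_of_continuous (hlog.mul hL)⟩]
  congr 1
  have h1 : ∀ v, Real.log (condTensor f N v) * L N (condTensor f N) v =
      N * (Real.log (condTensor f N v) * Q N (condTensor f N) v -
        condTensor f N v * Real.log (condTensor f N v)) := fun v => by
    rw [L]
    ring
  simp only [h1]
  have hlQ : Integrable (fun v => Real.log (condTensor f N v) * Q N (condTensor f N) v) (sigma N) :=
    integrable_of_continuous (hlog.mul hQ)
  have hFl : Integrable (fun v => condTensor f N v * Real.log (condTensor f N v)) (sigma N) :=
    integrable_of_continuous (hF.mul hlog)
  rw [integral_const_mul, integral_sub hlQ hFl, hf.integral_log_mul_Q hN,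
    hf.integral_densityMeasure hN1]
  ring

end RadialDensity

/-! ### From one-particle quantities to the limiting ratio -/

namespace RadialDensity

variable {f g : ℝ → ℝ} {K K' : ℝ}

/-- The conditioned tensor products have an entropy production ratio whose upper limit is at most
the ratio of the one-particle quantities. -/
theorem eventually_productionRatio_le (hf : RadialDensity f K) (hg : RadialDensity g K')
    {e c : ℝ} (hZ : ∀ N : ℕ, 1 ≤ N → Real.log (Z N g) = -(N * e)) (hc : 0 < c)
    (hH : 0 < ∫ v, Real.log (f v) ∂(lineMeasure f) + e)
    (hD : ∫ z, meanCollisionLoss f z ∂(Measure.pi fun _ => lineMeasure f) <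
      c * (∫ v, Real.log (f v) ∂(lineMeasure f) + e)) :
    ∀ᶠ N : ℕ in atTop, (0 < entropy N (condTensor f N) ∧ entropy N (condTensor f N) < ⊤) ∧
      productionRatio N (condTensor f N) ≤ (c : EReal) := by
  have := hf.isProbabilityMeasure
  have hK := hf.nonneg_const
  have hK' := hg.nonneg_const
  set h := ∫ v, Real.log (f v) ∂(lineMeasure f)
  set H := h + e
  set D := ∫ z, meanCollisionLoss f z ∂(Measure.pi fun _ => lineMeasure f)
  -- The entropy per particle will be at least `H - 3 * η` and the production at most `D + η`. The
  -- first entry keeps the former at least `H / 2`; the second solves `D + η ≤ c * (H - 3 * η)`. The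
  -- three losses `η` come from the mean of `log f`, the shell error and `log 2`.
  set η := min (H / 6) ((c * H - D) / (1 + 3 * c))
  have hη : 0 < η := lt_min (by positivity) (div_pos (by linarith) (by positivity))
  have hη1 : 3 * η ≤ H / 2 := by
    have : η ≤ H / 6 := min_le_left _ _
    linarith
  have hη2 : D + η ≤ c * (H - 3 * η) := by
    have : η ≤ (c * H - D) / (1 + 3 * c) := min_le_right _ _
    rw [le_div_iff₀ (by positivity)] at this
    linarith
  have hlog : QuadraticGrowth fun z : Fin 1 → ℝ => Real.log (f (z 0)) := by
    obtain ⟨C, hC⟩ := hf.log_growth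
    exact ⟨hf.continuous_log.comp (continuous_apply 0), C, fun z => by simpa using hC (z 0)⟩
  have hlogint : ∫ z : Fin 1 → ℝ, Real.log (f (z 0)) ∂(Measure.pi fun _ => lineMeasure f) = h :=
    integral_comp_eval (μ := fun _ : Fin 1 => lineMeasure f) (f := fun v => Real.log (f v))
      hf.continuous_log.aestronglyMeasurable
  have hloss : QuadraticGrowth fun z => -meanCollisionLoss f z := by
    obtain ⟨h1, C, hC⟩ := hf.quadraticGrowth_meanCollisionLoss
    exact ⟨h1.neg, C, fun z => by simpa using hC z⟩
  set ε := η / (K + K' + 1)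
  have hε : 0 < ε := by positivity
  have hε1 : (K + K') * ε ≤ η := by
    have : ε * (K + K' + 1) = η := div_mul_cancel₀ _ (by positivity)
    linarith
  filter_upwards [hf.eventually_le_integral_firstCoords le_rfl hlog hη,
    hf.eventually_le_integral_firstCoords (by norm_num) hloss hη, hg.shell_mass hε,
    eventually_ge_atTop 2,
    tendsto_natCast_atTop_atTop.eventually_ge_atTop (Real.log 2 / η)] with N h1 h2 hmass hN hNlog
  have hN1 : 1 ≤ N := by omega
  have hN' : (0 : ℝ) < N := by exact_mod_cast hN1
  rw [hlogint] at h1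
  rw [integral_neg, integral_neg] at h2
  rw [div_le_iff₀ hη] at hNlog
  have hZN := hf.log_Z_le hg hN1 hmass
  rw [hZ N hN1] at hZN
  have hent := hf.entropy_condTensor hN1
  have hX := hf.integral_log_condTensor hN1
  set X := ∫ v, Real.log (condTensor f N v) ∂(densityMeasure N (condTensor f N))
  set P := ∫ v, meanCollisionLoss f (firstCoords 2 N v) ∂(densityMeasure N (condTensor f N))
  have hXN : N * (H - 3 * η) ≤ X := by
    have h3 : N * (h - η) ≤ N * ∫ v, Real.log (f (firstCoords 1 N v 0))
        ∂(densityMeasure N (condTensor f N)) := by gcongr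
    have h4 : (K + K') * ε * N ≤ η * N := by gcongr
    have h5 : (N : ℝ) * H = N * h + N * e := by
      simp only [H]
      ring
    linarith
  have hX0 : 0 < X := lt_of_lt_of_le (mul_pos hN' (by linarith)) hXN
  have hPX : N * P ≤ c * X := by
    have h3 : N * P ≤ N * (D + η) := by
      gcongr
      linarith
    have h4 : N * (D + η) ≤ N * (c * (H - 3 * η)) := by gcongr
    have h5 : c * (N * (H - 3 * η)) ≤ c * X := by gcongr
    linarith
  refine ⟨⟨?_, ?_⟩, ?_⟩
  · rw [hent, ENNReal.ofReal_pos]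
    exact hX0
  · rw [hent]
    exact ENNReal.ofReal_lt_top
  · rw [productionRatio, hent, hf.entropyProduction_condTensor hN, EReal.coe_ennreal_ofReal,
      max_eq_left hX0.le, ← EReal.coe_div, EReal.coe_le_coe_iff, div_le_iff₀ hX0]
    exact hPX

end RadialDensity

/-! ### Mixtures of two Gaussians -/

open ProbabilityTheory
open scoped NNReal

/-- A mixture of two centred Gaussian densities of variances `a` and `b`. -/
def gaussianMix (p q : ℝ) (a b : ℝ≥0) (v : ℝ) : ℝ :=
  p * gaussianPDFReal 0 a v + q * gaussianPDFReal 0 b v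

theorem log_gaussianPDFReal {a : ℝ≥0} (ha : a ≠ 0) (x : ℝ) :
    Real.log (gaussianPDFReal 0 a x) = -(Real.log (2 * Real.pi * a) / 2) - x ^ 2 / (2 * a) := by
  have ha' : (0 : ℝ) < a := by positivity
  rw [gaussianPDFReal, Real.log_mul (by positivity) (Real.exp_pos _).ne', Real.log_exp,
    Real.log_inv, Real.log_sqrt (by positivity), sub_zero]
  ring

theorem contDiff_gaussianPDFReal (a : ℝ≥0) : ContDiff ℝ ∞ (gaussianPDFReal 0 a) := by
  rw [gaussianPDFReal_def]
  fun_prop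

/-- The exponent changes by `-(r ^ 2 - 1) * v ^ 2 / (2 * a)`, and `2 * a ≥ 1`. Keeping the variances
above `1/2` makes `K = 1` work for every mixture, since the bound is linear in the density. -/
theorem gaussianPDFReal_mul_le {a : ℝ≥0} (ha : (1 : ℝ) / 2 ≤ a) (r v : ℝ) :
    gaussianPDFReal 0 a (r * v) ≤ Real.exp (1 * |r ^ 2 - 1| * v ^ 2) * gaussianPDFReal 0 a v := by
  have ha' : (0 : ℝ) < a := by linarith
  rw [gaussianPDFReal, gaussianPDFReal, mul_left_comm, ← Real.exp_add]
  gcongr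
  rw [sub_zero, sub_zero, one_mul, ← sub_le_iff_le_add, ← sub_div, div_le_iff₀ (by positivity)]
  have h1 : -(r ^ 2 - 1) * v ^ 2 ≤ |r ^ 2 - 1| * v ^ 2 := by
    gcongr
    exact neg_le_abs _
  have h2 : |r ^ 2 - 1| * v ^ 2 * 1 ≤ |r ^ 2 - 1| * v ^ 2 * (2 * a) := by
    gcongr
    linarith
  linarith

theorem integrable_gaussianReal_iff {a : ℝ≥0} (ha : a ≠ 0) {h : ℝ → ℝ} :
    Integrable h (gaussianReal 0 a) ↔ Integrable fun v => h v * gaussianPDFReal 0 a v := by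
  rw [gaussianReal_of_var_ne_zero _ ha, integrable_withDensity_iff (by fun_prop)
    (ae_of_all _ fun _ => gaussianPDF_lt_top)]
  simp

theorem integrable_abs_pow_gaussianReal (a : ℝ≥0) (k : ℕ) :
    Integrable (fun v => |v| ^ k) (gaussianReal 0 a) := by
  have h := (memLp_id_gaussianReal (μ := 0) (v := a) k).integrable_norm_pow'
  simpa using h

theorem integral_sq_gaussianReal (a : ℝ≥0) : ∫ v, v ^ 2 ∂(gaussianReal 0 a) = a := by
  have h := variance_of_integral_eq_zero (μ := gaussianReal 0 a) (X := id) aemeasurable_id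
    (by simp)
  rw [variance_id_gaussianReal] at h
  exact h.symm

variable {p q : ℝ} {a b : ℝ≥0}

theorem integrable_mul_gaussianMix (ha : a ≠ 0) (hb : b ≠ 0) {h : ℝ → ℝ}
    (h1 : Integrable h (gaussianReal 0 a)) (h2 : Integrable h (gaussianReal 0 b)) :
    Integrable fun v => h v * gaussianMix p q a b v := by
  rw [integrable_gaussianReal_iff ha] at h1
  rw [integrable_gaussianReal_iff hb] at h2
  refine ((h1.const_mul p).add (h2.const_mul q)).congr (ae_of_all _ fun v => ?_)
  simp only [gaussianMix, Pi.add_apply]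
  ring

theorem integral_mul_gaussianMix (ha : a ≠ 0) (hb : b ≠ 0) {h : ℝ → ℝ}
    (h1 : Integrable h (gaussianReal 0 a)) (h2 : Integrable h (gaussianReal 0 b)) :
    ∫ v, h v * gaussianMix p q a b v =
      p * ∫ v, h v ∂(gaussianReal 0 a) + q * ∫ v, h v ∂(gaussianReal 0 b) := by
  rw [integrable_gaussianReal_iff ha] at h1
  rw [integrable_gaussianReal_iff hb] at h2
  rw [integral_gaussianReal_eq_integral_smul ha, integral_gaussianReal_eq_integral_smul hb,
    ← integral_const_mul, ← integral_const_mul, ← integral_add]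
  · refine integral_congr_ae (ae_of_all _ fun v => ?_)
    simp only [gaussianMix, smul_eq_mul]
    ring
  · simpa only [smul_eq_mul, mul_comm] using h1.const_mul p
  · simpa only [smul_eq_mul, mul_comm] using h2.const_mul q

/-- Weights and variances of a mixture of unit variance. -/
structure MixParam (p q : ℝ) (a b : ℝ≥0) : Prop where
  p_pos : 0 < p
  q_pos : 0 < q
  add_eq : p + q = 1
  half_le_a : (1 : ℝ) / 2 ≤ a
  a_le_b : a ≤ b
  energy : p * a + q * b = 1

namespace MixParam

theorem half_le_b (h : MixParam p q a b) : (1 : ℝ) / 2 ≤ b :=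
  h.half_le_a.trans (by exact_mod_cast h.a_le_b)

theorem a_pos (h : MixParam p q a b) : (0 : ℝ) < a := by linarith [h.half_le_a]

theorem b_pos (h : MixParam p q a b) : (0 : ℝ) < b := by linarith [h.half_le_b]

theorem a_ne (h : MixParam p q a b) : a ≠ 0 := fun e => by simpa [e] using h.a_pos

theorem b_ne (h : MixParam p q a b) : b ≠ 0 := fun e => by simpa [e] using h.b_pos

theorem radialDensity (h : MixParam p q a b) : RadialDensity (gaussianMix p q a b) 1 where
  pos v := add_pos (mul_pos h.p_pos (gaussianPDFReal_pos _ _ _ h.a_ne))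
    (mul_pos h.q_pos (gaussianPDFReal_pos _ _ _ h.b_ne))
  cont := ((contDiff_gaussianPDFReal a).continuous.const_mul p).add
    ((contDiff_gaussianPDFReal b).continuous.const_mul q)
  integrable_pow k := integrable_mul_gaussianMix h.a_ne h.b_ne
    (integrable_abs_pow_gaussianReal a k) (integrable_abs_pow_gaussianReal b k)
  mass := by
    have := integral_mul_gaussianMix (p := p) (q := q) h.a_ne h.b_ne (h := fun _ => 1)
      (integrable_const _) (integrable_const _)
    simpa [h.add_eq] using this
  second := by
    rw [integral_mul_gaussianMix h.a_ne h.b_ne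
      (by simpa using integrable_abs_pow_gaussianReal a 2)
      (by simpa using integrable_abs_pow_gaussianReal b 2), integral_sq_gaussianReal,
      integral_sq_gaussianReal, h.energy]
  nonneg_const := zero_le_one
  scale r v _ := by
    rw [gaussianMix, gaussianMix, mul_add, mul_left_comm _ p, mul_left_comm _ q]
    have h1 := mul_le_mul_of_nonneg_left (gaussianPDFReal_mul_le h.half_le_a r v) h.p_pos.le
    have h2 := mul_le_mul_of_nonneg_left (gaussianPDFReal_mul_le h.half_le_b r v) h.q_pos.le
    exact add_le_add h1 h2

theorem contDiff (p q : ℝ) (a b : ℝ≥0) : ContDiff ℝ ∞ (gaussianMix p q a b) :=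
  (contDiff_const.mul (contDiff_gaussianPDFReal a)).add
    (contDiff_const.mul (contDiff_gaussianPDFReal b))

theorem integral_mul_self (h : MixParam p q a b) : ∫ v, v * gaussianMix p q a b v = 0 := by
  have h1 : ∀ c : ℝ≥0, Integrable (fun v : ℝ => v) (gaussianReal 0 c) := fun c =>
    (memLp_id_gaussianReal (μ := 0) (v := c) 1).integrable (by simp)
  rw [integral_mul_gaussianMix h.a_ne h.b_ne (h1 a) (h1 b)]
  simp

/-- The peak value is `1 / √(2 π a)`, and `2 π a ≥ π > 1`. This makes `log f ≤ 0`, which disposes of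
the incoming particles in the collision bound. -/
theorem gaussianPDFReal_le_one {a : ℝ≥0} (ha : (1 : ℝ) / 2 ≤ a) (v : ℝ) :
    gaussianPDFReal 0 a v ≤ 1 := by
  have h1 : 1 ≤ √(2 * Real.pi * a) := by
    rw [Real.one_le_sqrt]
    nlinarith [Real.pi_gt_three]
  rw [gaussianPDFReal]
  refine mul_le_one₀ (inv_le_one_of_one_le₀ h1) (Real.exp_pos _).le (Real.exp_le_one_iff.mpr ?_)
  exact div_nonpos_of_nonpos_of_nonneg (by nlinarith [sq_nonneg (v - 0)]) (by positivity)

theorem le_one (h : MixParam p q a b) (v : ℝ) : gaussianMix p q a b v ≤ 1 := by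
  have h1 := mul_le_mul_of_nonneg_left (gaussianPDFReal_le_one h.half_le_a v) h.p_pos.le
  have h2 := mul_le_mul_of_nonneg_left (gaussianPDFReal_le_one h.half_le_b v) h.q_pos.le
  rw [gaussianMix]
  linarith [h.add_eq]

theorem log_nonpos (h : MixParam p q a b) (v : ℝ) : Real.log (gaussianMix p q a b v) ≤ 0 :=
  Real.log_nonpos (h.radialDensity.pos v).le (h.le_one v)

theorem le_log_left (h : MixParam p q a b) (v : ℝ) :
    Real.log p - Real.log (2 * Real.pi * a) / 2 - v ^ 2 / (2 * a) ≤
      Real.log (gaussianMix p q a b v) := by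
  have ha := gaussianPDFReal_pos 0 a v h.a_ne
  have hb := gaussianPDFReal_pos 0 b v h.b_ne
  have := Real.log_le_log (mul_pos h.p_pos ha) (show p * gaussianPDFReal 0 a v ≤
    gaussianMix p q a b v from le_add_of_nonneg_right (mul_pos h.q_pos hb).le)
  rw [Real.log_mul h.p_pos.ne' ha.ne', log_gaussianPDFReal h.a_ne] at this
  linarith

/-- Dropping the cold component leaves a floor with the wide Gaussian tail. It serves for the
entropy of the hot population and for the outgoing particles of a mixed collision. -/
theorem le_log_right (h : MixParam p q a b) (v : ℝ) :
    Real.log q - Real.log (2 * Real.pi * b) / 2 - v ^ 2 / (2 * b) ≤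
      Real.log (gaussianMix p q a b v) := by
  have ha := gaussianPDFReal_pos 0 a v h.a_ne
  have hb := gaussianPDFReal_pos 0 b v h.b_ne
  have := Real.log_le_log (mul_pos h.q_pos hb) (show q * gaussianPDFReal 0 b v ≤
    gaussianMix p q a b v from le_add_of_nonneg_left (mul_pos h.p_pos ha).le)
  rw [Real.log_mul h.q_pos.ne' hb.ne', log_gaussianPDFReal h.b_ne] at this
  linarith

theorem integrable_log (h : MixParam p q a b) (c : ℝ≥0) :
    Integrable (fun v => Real.log (gaussianMix p q a b v)) (gaussianReal 0 c) := by
  obtain ⟨C, hC⟩ := h.radialDensity.log_growth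
  refine Integrable.mono' (((integrable_const 1).add
    (by simpa using integrable_abs_pow_gaussianReal c 2 :
      Integrable (fun v : ℝ => v ^ 2) (gaussianReal 0 c))).const_mul C)
    h.radialDensity.continuous_log.aestronglyMeasurable (ae_of_all _ fun v => hC v)

/-- Lower bound for the (negative) differential entropy of the mixture. -/
theorem le_integral_log (h : MixParam p q a b) :
    p * (Real.log p - Real.log (2 * Real.pi * a) / 2 - 1 / 2) +
      q * (Real.log q - Real.log (2 * Real.pi * b) / 2 - 1 / 2) ≤
      ∫ v, Real.log (gaussianMix p q a b v) ∂(lineMeasure (gaussianMix p q a b)) := by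
  have hsq : ∀ c : ℝ≥0, Integrable (fun v : ℝ => v ^ 2) (gaussianReal 0 c) := fun c => by
    simpa using integrable_abs_pow_gaussianReal c 2
  -- Each population is paired with the floor of its own variance `c`, against which `v ^ 2 / (2 *
  -- c)` averages to `1/2`.
  have key : ∀ (c : ℝ≥0) (t : ℝ), (0 : ℝ) < c →
      (∀ v, t - v ^ 2 / (2 * c) ≤ Real.log (gaussianMix p q a b v)) →
      t - 1 / 2 ≤ ∫ v, Real.log (gaussianMix p q a b v) ∂(gaussianReal 0 c) := by
    intro c t hc ht
    have h1 := integral_mono ((integrable_const t).sub ((hsq c).div_const (2 * c)))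
      (h.integrable_log c) ht
    simp only [Pi.sub_apply] at h1
    rw [integral_sub (integrable_const t) ((hsq c).div_const _), integral_div,
      integral_sq_gaussianReal] at h1
    have h2 : (c : ℝ) / (2 * c) = 1 / 2 := by field_simp
    simpa [h2] using h1
  rw [h.radialDensity.integral_lineMeasure, integral_mul_gaussianMix h.a_ne h.b_ne
    (h.integrable_log a) (h.integrable_log b)]
  have h1 := key a _ h.a_pos h.le_log_left
  have h2 := key b _ h.b_pos h.le_log_right
  have hp := h.p_pos
  have hq := h.q_pos
  gcongr

theorem lineMeasure_eq (h : MixParam p q a b) : lineMeasure (gaussianMix p q a b) =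
    ENNReal.ofReal p • gaussianReal 0 a + ENNReal.ofReal q • gaussianReal 0 b := by
  rw [gaussianReal_of_var_ne_zero _ h.a_ne, gaussianReal_of_var_ne_zero _ h.b_ne,
    ← withDensity_smul _ (by fun_prop), ← withDensity_smul _ (by fun_prop),
    ← withDensity_add_left (by fun_prop), lineMeasure]
  congr 1
  funext v
  have hp := h.p_pos
  have hq := h.q_pos
  have := gaussianPDFReal_nonneg 0 a v
  have := gaussianPDFReal_nonneg 0 b v
  simp only [gaussianMix, Pi.add_apply, Pi.smul_apply, smul_eq_mul, gaussianPDF]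
  rw [ENNReal.ofReal_add (by positivity) (by positivity), ENNReal.ofReal_mul hp.le,
    ENNReal.ofReal_mul hq.le]

theorem integrable_add_sq_prod (c d : ℝ≥0) :
    Integrable (fun z : ℝ × ℝ => z.1 ^ 2 + z.2 ^ 2) ((gaussianReal 0 c).prod (gaussianReal 0 d)) := by
  have hsq : ∀ c : ℝ≥0, Integrable (fun v : ℝ => v ^ 2) (gaussianReal 0 c) := fun c => by
    simpa using integrable_abs_pow_gaussianReal c 2
  exact ((hsq c).comp_fst _).add ((hsq d).comp_snd _)

theorem integral_add_sq_prod (c d : ℝ≥0) :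
    ∫ z : ℝ × ℝ, (z.1 ^ 2 + z.2 ^ 2) ∂((gaussianReal 0 c).prod (gaussianReal 0 d)) = c + d := by
  have hsq : ∀ c : ℝ≥0, Integrable (fun v : ℝ => v ^ 2) (gaussianReal 0 c) := fun c => by
    simpa using integrable_abs_pow_gaussianReal c 2
  rw [integral_add ((hsq c).comp_fst _) ((hsq d).comp_snd _),
    integral_fun_fst (fun v : ℝ => v ^ 2), integral_fun_snd (fun v : ℝ => v ^ 2)]
  simp [integral_sq_gaussianReal]

theorem integrable_collisionLoss (h : MixParam p q a b) (c d : ℝ≥0) (θ : ℝ) :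
    Integrable (fun z : ℝ × ℝ => collisionLoss (gaussianMix p q a b) z.1 z.2 θ)
      ((gaussianReal 0 c).prod (gaussianReal 0 d)) := by
  obtain ⟨C, hC⟩ := h.radialDensity.collisionLoss_growth
  exact Integrable.mono' (((integrable_const 1).add (integrable_add_sq_prod c d)).const_mul C)
    (h.radialDensity.continuous_collisionLoss_left θ).aestronglyMeasurable
    (ae_of_all _ fun z => hC z.1 z.2 θ)

/-- Collisions inside one Gaussian population produce no entropy. -/
theorem integral_collisionLoss_same (h : MixParam p q a b) (c : ℝ≥0) (θ : ℝ) :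
    ∫ z : ℝ × ℝ, collisionLoss (gaussianMix p q a b) z.1 z.2 θ
      ∂((gaussianReal 0 c).prod (gaussianReal 0 c)) = 0 := by
  have hlog := h.radialDensity.continuous_log
  set l : ℝ × ℝ → ℝ := fun z =>
    Real.log (gaussianMix p q a b z.1) + Real.log (gaussianMix p q a b z.2)
  have hl : Continuous l := (hlog.comp continuous_fst).add (hlog.comp continuous_snd)
  have hli : Integrable l ((gaussianReal 0 c).prod (gaussianReal 0 c)) :=
    ((h.integrable_log c).comp_fst _).add ((h.integrable_log c).comp_snd _)
  -- A product of two equal centred Gaussians is rotation invariant, so incoming and outgoing pairs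
  -- have the same law, whatever function `log f` is.
  have hrot := IsGaussian.map_rotation_eq_self (μ := gaussianReal 0 c) (by simp) θ
  have hm : AEMeasurable (ContinuousLinearMap.rotation θ : ℝ × ℝ →L[ℝ] ℝ × ℝ)
      ((gaussianReal 0 c).prod (gaussianReal 0 c)) := by fun_prop
  have hli' : Integrable (fun z => l (ContinuousLinearMap.rotation θ z))
      ((gaussianReal 0 c).prod (gaussianReal 0 c)) := by
    have h1 := hli
    rw [← hrot] at h1
    exact h1.comp_aemeasurable hm
  have hint : ∫ z, l (ContinuousLinearMap.rotation θ z)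
      ∂((gaussianReal 0 c).prod (gaussianReal 0 c)) =
      ∫ z, l z ∂((gaussianReal 0 c).prod (gaussianReal 0 c)) := by
    conv_rhs => rw [← hrot]
    rw [integral_map hm hl.aestronglyMeasurable]
  have heq : ∀ z : ℝ × ℝ, collisionLoss (gaussianMix p q a b) z.1 z.2 θ =
      l z - l (ContinuousLinearMap.rotation θ z) := fun z => by
    rw [collisionLoss, sub_sub]
    rfl
  simp only [heq]
  rw [integral_sub hli hli', hint, sub_self]

/-- The incoming logarithms are nonpositive and the outgoing ones lie above the hot floor. The
collision conserves energy, so the quadratic terms of the two floors add up to `(x ^ 2 + y ^ 2) / (2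
* b)`, whose mean `(c + d) / (2 * b)` is at most `1`. -/
theorem integral_collisionLoss_cross (h : MixParam p q a b) {c d : ℝ≥0}
    (hcd : (c : ℝ) + d ≤ 2 * b) (θ : ℝ) :
    ∫ z : ℝ × ℝ, collisionLoss (gaussianMix p q a b) z.1 z.2 θ
      ∂((gaussianReal 0 c).prod (gaussianReal 0 d)) ≤
      Real.log (2 * Real.pi * b) - 2 * Real.log q + 1 := by
  have hb := h.b_pos
  set t := Real.log (2 * Real.pi * b) - 2 * Real.log q
  have hpt : ∀ z : ℝ × ℝ, collisionLoss (gaussianMix p q a b) z.1 z.2 θ ≤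
      t + (z.1 ^ 2 + z.2 ^ 2) / (2 * b) := by
    intro z
    have h1 := h.log_nonpos z.1
    have h2 := h.log_nonpos z.2
    have h3 := h.le_log_right (Real.cos θ * z.1 + Real.sin θ * z.2)
    have h4 := h.le_log_right (-Real.sin θ * z.1 + Real.cos θ * z.2)
    have h5 : (Real.cos θ * z.1 + Real.sin θ * z.2) ^ 2 / (2 * b) +
        (-Real.sin θ * z.1 + Real.cos θ * z.2) ^ 2 / (2 * b) =
        (z.1 ^ 2 + z.2 ^ 2) / (2 * b) := by
      rw [← add_div]
      congr 1
      linear_combination (z.1 ^ 2 + z.2 ^ 2) * Real.sin_sq_add_cos_sq θ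
    rw [collisionLoss]
    simp only [t]
    linarith
  have hi := integrable_add_sq_prod c d
  have hmono := integral_mono (h.integrable_collisionLoss c d θ)
    ((integrable_const t).add (hi.div_const (2 * b))) hpt
  simp only [Pi.add_apply] at hmono
  rw [integral_add (integrable_const t) (hi.div_const _), integral_div,
    integral_add_sq_prod] at hmono
  have h6 : ((c : ℝ) + d) / (2 * b) ≤ 1 := (div_le_one (by positivity)).mpr hcd
  simp only [integral_const, probReal_univ, one_smul] at hmono
  linarith

/-- Expanding the product of two mixtures gives four population pairs. The two equal pairs vanish,
and the two mixed ones carry weight `p * q` each. -/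
theorem integral_collisionLoss_le (h : MixParam p q a b) (θ : ℝ) :
    ∫ z : ℝ × ℝ, collisionLoss (gaussianMix p q a b) z.1 z.2 θ
      ∂((lineMeasure (gaussianMix p q a b)).prod (lineMeasure (gaussianMix p q a b))) ≤
      2 * p * q * (Real.log (2 * Real.pi * b) - 2 * Real.log q + 1) := by
  have hp := h.p_pos
  have hq := h.q_pos
  have hi := fun c d => h.integrable_collisionLoss c d θ
  have hab : (a : ℝ) ≤ b := by exact_mod_cast h.a_le_b
  have h1 := h.integral_collisionLoss_cross (c := a) (d := b) (by linarith) θ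
  have h2 := h.integral_collisionLoss_cross (c := b) (d := a) (by linarith) θ
  rw [h.lineMeasure_eq, Measure.prod_add, Measure.add_prod, Measure.add_prod]
  simp only [Measure.prod_smul_left, Measure.prod_smul_right]
  have hs : ∀ c d : ℝ≥0, ∀ s t : ℝ, Integrable
      (fun z : ℝ × ℝ => collisionLoss (gaussianMix p q a b) z.1 z.2 θ)
      (ENNReal.ofReal s • ENNReal.ofReal t • (gaussianReal 0 c).prod (gaussianReal 0 d)) :=
    fun c d s t => ((hi c d).smul_measure ENNReal.ofReal_ne_top).smul_measure ENNReal.ofReal_ne_top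
  rw [integral_add_measure ((hs _ _ _ _).add_measure (hs _ _ _ _))
    ((hs _ _ _ _).add_measure (hs _ _ _ _)), integral_add_measure (hs _ _ _ _) (hs _ _ _ _),
    integral_add_measure (hs _ _ _ _) (hs _ _ _ _)]
  simp only [integral_smul_measure, ENNReal.toReal_ofReal hp.le, ENNReal.toReal_ofReal hq.le,
    smul_eq_mul, h.integral_collisionLoss_same, mul_zero, zero_add, add_zero]
  set T := Real.log (2 * Real.pi * b) - 2 * Real.log q + 1
  have h3 : p * q * ∫ z : ℝ × ℝ, collisionLoss (gaussianMix p q a b) z.1 z.2 θ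
      ∂((gaussianReal 0 a).prod (gaussianReal 0 b)) ≤ p * q * T := by gcongr
  have h4 : p * q * ∫ z : ℝ × ℝ, collisionLoss (gaussianMix p q a b) z.1 z.2 θ
      ∂((gaussianReal 0 b).prod (gaussianReal 0 a)) ≤ p * q * T := by gcongr
  linarith

theorem integral_meanCollisionLoss_le (h : MixParam p q a b) :
    ∫ z, meanCollisionLoss (gaussianMix p q a b) z
      ∂(Measure.pi fun _ : Fin 2 => lineMeasure (gaussianMix p q a b)) ≤
      2 * p * q * (Real.log (2 * Real.pi * b) - 2 * Real.log q + 1) := by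
  have hf := h.radialDensity
  have := hf.isProbabilityMeasure
  have hpi := Real.pi_pos
  set f := gaussianMix p q a b
  set μ := lineMeasure f
  set T := 2 * p * q * (Real.log (2 * Real.pi * b) - 2 * Real.log q + 1)
  have hint : Integrable (Function.uncurry fun (θ : ℝ) (z : ℝ × ℝ) => collisionLoss f z.1 z.2 θ)
      ((volume.restrict (Set.uIoc 0 (2 * Real.pi))).prod (μ.prod μ)) := by
    obtain ⟨C, hC⟩ := hf.collisionLoss_growth
    have hsq : Integrable (fun z : ℝ × ℝ => z.1 ^ 2 + z.2 ^ 2) (μ.prod μ) :=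
      (hf.integrable_sq.comp_fst _).add (hf.integrable_sq.comp_snd _)
    have : IsFiniteMeasure (volume.restrict (Set.uIoc 0 (2 * Real.pi))) :=
      isFiniteMeasure_restrict.mpr measure_Ioc_lt_top.ne
    refine Integrable.mono' ((((integrable_const 1).add hsq).const_mul C).comp_snd _)
      (hf.continuous_collisionLoss.comp continuous_swap).aestronglyMeasurable
      (ae_of_all _ fun z => hC z.2.1 z.2.2 z.1)
  have h1 : ∫ z, meanCollisionLoss f z ∂(Measure.pi fun _ : Fin 2 => μ) =
      ∫ z : ℝ × ℝ, (2 * Real.pi)⁻¹ * (∫ θ in (0 : ℝ)..(2 * Real.pi),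
        collisionLoss f z.1 z.2 θ) ∂(μ.prod μ) :=
    (measurePreserving_finTwoArrow μ).integral_comp' (f := MeasurableEquiv.finTwoArrow)
      (fun z : ℝ × ℝ => (2 * Real.pi)⁻¹ * (∫ θ in (0 : ℝ)..(2 * Real.pi),
        collisionLoss f z.1 z.2 θ))
  rw [h1, integral_const_mul, ← intervalIntegral_integral_swap hint, inv_mul_le_iff₀ (by positivity)]
  have h2 : ∫ θ in (0 : ℝ)..(2 * Real.pi), (∫ z : ℝ × ℝ, collisionLoss f z.1 z.2 θ ∂(μ.prod μ)) ≤
      ∫ _ in (0 : ℝ)..(2 * Real.pi), T :=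
    intervalIntegral.integral_mono_on (by positivity)
      (intervalIntegrable_iff.mpr hint.integral_prod_left) (by simp)
      fun θ _ => h.integral_collisionLoss_le θ
  simpa using h2

/-- The variances are inverse to the weights, so each population has energy `1/2`. -/
theorem two_variances (δ : ℝ) (h0 : 0 < δ) (h1 : δ ≤ 1 / 2) :
    MixParam (1 - δ) δ (Real.toNNReal (1 / (2 * (1 - δ)))) (Real.toNNReal (1 / (2 * δ))) := by
  have h2 : 0 < 1 - δ := by linarith
  refine ⟨h2, h0, by ring, ?_, ?_, ?_⟩
  · rw [Real.coe_toNNReal _ (by positivity)]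
    gcongr
    linarith
  · refine Real.toNNReal_le_toNNReal ?_
    gcongr
    linarith
  · rw [Real.coe_toNNReal _ (by positivity), Real.coe_toNNReal _ (by positivity)]
    field_simp
    norm_num

end MixParam

/-! ### The Gaussian reference and the choice of the mixture -/

/-- The standard Gaussian is seen as a degenerate mixture so that the estimates for mixtures cover
the reference density too. -/
theorem mixParam_standard : MixParam (1 / 2) (1 / 2) 1 1 := by
  constructor <;> norm_num

theorem log_Z_standard {N : ℕ} (hN : 1 ≤ N) :
    Real.log (Z N (gaussianMix (1 / 2) (1 / 2) 1 1)) =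
      -(N * (Real.log (2 * Real.pi) / 2 + 1 / 2)) := by
  have := isProbabilityMeasure_sigma hN
  have hγ : ∀ x, gaussianMix (1 / 2) (1 / 2) 1 1 x =
      Real.exp (-(Real.log (2 * Real.pi) / 2) - x ^ 2 / 2) := fun x => by
    have h := log_gaussianPDFReal one_ne_zero x
    simp only [NNReal.coe_one, mul_one] at h
    rw [← h, Real.exp_log (gaussianPDFReal_pos _ _ _ one_ne_zero), gaussianMix]
    ring
  have hprod : ∀ v : KacSphere N, ∏ j, gaussianMix (1 / 2) (1 / 2) 1 1
      ((v : EuclideanSpace ℝ (Fin N)) j) =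
      Real.exp (-(N * (Real.log (2 * Real.pi) / 2 + 1 / 2))) := fun v => by
    simp only [hγ]
    rw [← Real.exp_sum, Finset.sum_sub_distrib, ← Finset.sum_div, sum_sq_kacSphere]
    congr 1
    simp
    ring
  rw [Z]
  simp only [hprod]
  simp

/-- For small `δ` the mixture dissipates little entropy while its entropy stays bounded below. -/
theorem exists_mixParam {c : ℝ} (hc : 0 < c) : ∃ (p q : ℝ) (a b : ℝ≥0), MixParam p q a b ∧
    0 < ∫ v, Real.log (gaussianMix p q a b v) ∂(lineMeasure (gaussianMix p q a b)) +
      (Real.log (2 * Real.pi) / 2 + 1 / 2) ∧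
    ∫ z, meanCollisionLoss (gaussianMix p q a b) z
      ∂(Measure.pi fun _ => lineMeasure (gaussianMix p q a b)) <
      c * (∫ v, Real.log (gaussianMix p q a b v) ∂(lineMeasure (gaussianMix p q a b)) +
        (Real.log (2 * Real.pi) / 2 + 1 / 2)) := by
  -- With the variances of `two_variances`, `u δ` is the entropy bound of `le_integral_log` relative
  -- to the Gaussian and `w δ` is the bound of `integral_meanCollisionLoss_le`. As `δ * log δ` is
  -- continuous with value `0` at `0`, they extend continuously with `u 0 = (log 2) / 2` and `w 0 =
  -- 0`.
  set u : ℝ → ℝ := fun δ => 3 / 2 * ((1 - δ) * Real.log (1 - δ) + δ * Real.log δ) + Real.log 2 / 2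
  set w : ℝ → ℝ := fun δ => 2 * (1 - δ) * (δ * (Real.log Real.pi + 1) - 3 * (δ * Real.log δ))
  have hu : Continuous u := by
    have h1 := Real.continuous_mul_log
    have h2 : Continuous fun δ : ℝ => (1 - δ) * Real.log (1 - δ) :=
      h1.comp (continuous_const.sub continuous_id)
    fun_prop
  have hw : Continuous w := by
    have h1 := Real.continuous_mul_log
    fun_prop
  have hlog2 : 0 < Real.log 2 := Real.log_pos (by norm_num)
  have hu0 : 0 < u 0 := by
    simp only [u]
    norm_num
    exact hlog2
  have huw : w 0 < c * u 0 := by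
    have : w 0 = 0 := by simp [w]
    rw [this]
    positivity
  have hev : ∀ᶠ δ in 𝓝[>] (0 : ℝ), (0 < u δ ∧ w δ < c * u δ) ∧ δ ≤ 1 / 2 := by
    refine Filter.Eventually.filter_mono nhdsWithin_le_nhds ?_
    exact ((hu.continuousAt.eventually_const_lt hu0).and
      (hw.continuousAt.eventually_lt (hu.const_mul c).continuousAt huw)).and
        (eventually_le_nhds (by norm_num))
  obtain ⟨δ, ⟨⟨h1, h2⟩, h3⟩, h4⟩ := (hev.and self_mem_nhdsWithin).exists
  have h0 : 0 < δ := h4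
  have h5 : 0 < 1 - δ := by linarith
  have hmix := MixParam.two_variances δ h0 h3
  have hpi := Real.pi_pos
  have hA := hmix.le_integral_log
  have hB := hmix.integral_meanCollisionLoss_le
  rw [Real.coe_toNNReal _ (by positivity)] at hA hB
  rw [Real.coe_toNNReal _ (by positivity)] at hA
  have e1 : ∀ t : ℝ, 0 < t → Real.log (2 * Real.pi * (1 / (2 * t))) =
      Real.log Real.pi - Real.log t := fun t ht => by
    rw [show 2 * Real.pi * (1 / (2 * t)) = Real.pi / t by field_simp,
      Real.log_div hpi.ne' ht.ne']
  rw [e1 δ h0] at hA hB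
  rw [e1 _ h5] at hA
  have hu' : u δ ≤ ∫ v, Real.log (gaussianMix (1 - δ) δ (Real.toNNReal (1 / (2 * (1 - δ))))
      (Real.toNNReal (1 / (2 * δ))) v) ∂(lineMeasure (gaussianMix (1 - δ) δ
        (Real.toNNReal (1 / (2 * (1 - δ)))) (Real.toNNReal (1 / (2 * δ))))) +
      (Real.log (2 * Real.pi) / 2 + 1 / 2) := by
    rw [Real.log_mul (by norm_num) hpi.ne']
    refine le_trans (le_of_eq ?_) (add_le_add_left hA _)
    simp only [u]
    ring
  refine ⟨_, _, _, _, hmix, h1.trans_le hu', ?_⟩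
  refine hB.trans_lt (lt_of_eq_of_lt ?_ (h2.trans_le (mul_le_mul_of_nonneg_left hu' hc.le)))
  simp only [w]
  ring

end KacModel

end

/-! ### The theorem -/

theorem mainTheorem1 :
    (∀ c : ℝ, 0 < c → ∃ f : ℝ → ℝ,
      -- `f` is a smooth bounded probability density on `ℝ` with moments of all orders,
      -- mean zero and unit variance
      (∀ v, 0 ≤ f v) ∧
      ContDiff ℝ ∞ f ∧
      (∃ C : ℝ, ∀ v, f v ≤ C) ∧
      (∀ k : ℕ, Integrable (fun v : ℝ => |v| ^ k * f v)) ∧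
      (∫ v : ℝ, f v = 1) ∧
      (∫ v : ℝ, v * f v = 0) ∧
      (∫ v : ℝ, v ^ 2 * f v = 1) ∧
      -- the conditioned tensor products are probability densities and form a chaotic family
      (∀ N : ℕ, 1 ≤ N → KacModel.IsProbDensity N (KacModel.condTensor f N)) ∧
      KacModel.IsChaotic (KacModel.lineMeasure f)
        (fun N => KacModel.densityMeasure N (KacModel.condTensor f N)) ∧
      -- the ratio is meaningful for all large `N`, and its limsup is at most `c`
      (∀ᶠ N : ℕ in atTop, 0 < KacModel.entropy N (KacModel.condTensor f N) ∧
        KacModel.entropy N (KacModel.condTensor f N) < ⊤) ∧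
      limsup (fun N : ℕ => KacModel.productionRatio N (KacModel.condTensor f N)) atTop
        ≤ (c : EReal)) ∧
    -- no positive constant is a lower bound for `Γ_N`, even for all large `N` only
    ¬ ∃ c : ℝ, 0 < c ∧ ∀ᶠ N : ℕ in atTop, (c : EReal) ≤ KacModel.Gam N := by
  have hratio : ∀ c : ℝ, 0 < c → ∃ (p q : ℝ) (a b : NNReal), KacModel.MixParam p q a b ∧
      ∀ᶠ N : ℕ in atTop,
        (0 < KacModel.entropy N (KacModel.condTensor (KacModel.gaussianMix p q a b) N) ∧
          KacModel.entropy N (KacModel.condTensor (KacModel.gaussianMix p q a b) N) < ⊤) ∧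
        KacModel.productionRatio N (KacModel.condTensor (KacModel.gaussianMix p q a b) N) ≤
          (c : EReal) := by
    intro c hc
    obtain ⟨p, q, a, b, hmix, hH, hD⟩ := KacModel.exists_mixParam hc
    exact ⟨p, q, a, b, hmix, hmix.radialDensity.eventually_productionRatio_le
      KacModel.mixParam_standard.radialDensity (fun _ => KacModel.log_Z_standard) hc hH hD⟩
  constructor
  · intro c hc
    obtain ⟨p, q, a, b, hmix, hev⟩ := hratio c hc
    have hf := hmix.radialDensity
    exact ⟨KacModel.gaussianMix p q a b, fun v => (hf.pos v).le,
      KacModel.MixParam.contDiff p q a b, ⟨1, hmix.le_one⟩, hf.integrable_pow, hf.mass,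
      hmix.integral_mul_self, hf.second, fun _ hN => hf.isProbDensity hN, hf.isChaotic,
      hev.mono fun _ h => h.1, limsup_le_of_le isCobounded_le_of_bot (hev.mono fun _ h => h.2)⟩
  · rintro ⟨c, hc, hGam⟩
    -- Half of the supposed bound is taken because the ratio is only known to be at most the
    -- prescribed constant, and a strict contradiction is needed.
    obtain ⟨p, q, a, b, hmix, hev⟩ := hratio (c / 2) (half_pos hc)
    obtain ⟨N, ⟨hN, ⟨h0, htop⟩, hle⟩, hN1⟩ := ((hGam.and hev).and (eventually_ge_atTop 1)).exists
    have hmem : KacModel.Gam N ≤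
        KacModel.productionRatio N (KacModel.condTensor (KacModel.gaussianMix p q a b) N) :=
      sInf_le ⟨_, hmix.radialDensity.isProbDensity hN1, h0.ne', htop.ne, rfl⟩
    have hcc : c ≤ c / 2 := EReal.coe_le_coe_iff.mp (hN.trans (hmem.trans hle))
    linarith
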